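/- Consider a cell-free massive MIMO system with $N$ access points (APs) of $L$ antennas each, $U$ unicast users and $M$ multicast groups, the $m$-th of which has $K_m\ge 1$ users. The channels from AP $n$ are $\mathbf c_{n,u}=\beta_{n,u}^{1/2}\mathbf h_{n,u}\in\mathbb C^{L}$ (unicast user $u$) and $\mathbf t_{n,m,k}=\bar\beta_{n,m,k}^{1/2}\mathbf h_{n,m,k}\in\mathbb C^{L}$ (user $k$ of group $m$), with $\beta_{n,u},\bar\beta_{n,m,k}>0$. Training. Unicast user $u$ sends the pilot $\boldsymbol\phi_u\in\mathbb C^{\tau}$ and all users of group $m$ send the pilot $\boldsymbol\varphi_m\in\mathbb C^\tau$; these $U+M$ pilots are orthonormal. With uplink power $p_{\rm ul}>0$, AP $n$ receives $$\mathbf Y_n=\sqrt{\tau p_{\rm ul}}\sum_{u}\mathbf c_{n,u}\boldsymbol\phi_u^H+\sqrt{\tau p_{\rm ul}}\sum_m\sum_{k}\mathbf t_{n,m,k}\boldsymbol\varphi_m^H+\boldsymbol\Psi_n .$$ All entries of all $\mathbf h_{n,u}$, $\mathbf h_{n,m,k}$ and $\boldsymbol\Psi_n\in\mathbb C^{L\times\tau}$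 are independent $\mathcal{CN}(0,1)$ variables. Put $\mathbf y_{n,u}=\mathbf Y_n\boldsymbol\phi_u$, $\bar{\mathbf y}_{n,m}=\mathbf Y_n\boldsymbol\varphi_m$. The local MMSE estimates are $$\hat{\mathbf c}_{n,u}=\mathbb E\{\mathbf c_{n,u}\mathbf y_{n,u}^H\}\big(\mathbb E\{\mathbf y_{n,u}\mathbf y_{n,u}^H\}\big)^{-1}\mathbf y_{n,u},\qquad \hat{\mathbf t}_{n,m}=\sum_{k}\mathbb E\{\mathbf t_{n,m,k}\bar{\mathbf y}_{n,m}^H\}\big(\mathbb E\{\bar{\mathbf y}_{n,m}\bar{\mathbf y}_{n,m}^H\}\big)^{-1}\bar{\mathbf y}_{n,m}.$$ Precoding. Under MR, $\mathbf b_{n,u}=\hat{\mathbf c}_{n,u}$ and $\bar{\mathbf b}_{n,m}=\hat{\mathbf t}_{n,m}$. Under ZF, with $\hat{\mathbf G}_n=[\hat{\mathbf c}_{n,1},\dots,\hat{\mathbf c}_{n,U},\hat{\mathbf t}_{n,1},\dots,\hat{\mathbf t}_{n,M}]$, the vectors $\mathbf b_{n,u}$ and $\bar{\mathbf b}_{n,m}$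 are the $u$-th and the $(U+m)$-th column of $\hat{\mathbf G}_n(\hat{\mathbf G}_n^H\hat{\mathbf G}_n)^{-1}$. Let $a_{n,u},\bar a_{n,m}\in\{0,1\}$ be AP association variables, $\eta_{n,u},\bar\eta_{n,m}\ge 0$ power control coefficients and $p_{\rm dl}\ge 0$ the downlink power. Define $$\mathrm{UI}_{u,u'}=\sqrt{p_{\rm dl}}\sum_n a_{n,u'}\sqrt{\eta_{n,u'}}\,\mathbf c_{n,u}^H\mathbf b_{n,u'},\qquad \mathrm{MI}_{u,m}=\sqrt{p_{\rm dl}}\sum_n \bar a_{n,m}\sqrt{\bar\eta_{n,m}}\,\mathbf c_{n,u}^H\bar{\mathbf b}_{n,m},$$ $\mathrm{DS}_u=\mathbb E\{\mathrm{UI}_{u,u}\}$, $\mathrm{BU}_u=\mathrm{UI}_{u,u}-\mathbb E\{\mathrm{UI}_{u,u}\}$, and the use-and-then-forget SINR of unicast user $u$, $$\mathrm{SINR}_u=\frac{|\mathrm{DS}_u|^2}{\mathbb E\{|\mathrm{BU}_u|^2\}+\sum_{u'\ne u}\mathbb E\{|\mathrm{UI}_{u,u'}|^2\}+\sum_m\mathbb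 E\{|\mathrm{MI}_{u,m}|^2\}+1}.$$ Then, for all $n,u,m,l$, the variances of the entries of the estimates are $$\mathbb E\{|[\hat{\mathbf c}_{n,u}]_l|^2\}=\gamma_{n,u}:=\frac{\tau p_{\rm ul}\beta_{n,u}^2}{\tau p_{\rm ul}\beta_{n,u}+1},\qquad \mathbb E\{|[\hat{\mathbf t}_{n,m}]_l|^2\}=\zeta_{n,m}:=\frac{\big(\sqrt{\tau p_{\rm ul}}\sum_k\bar\beta_{n,m,k}\big)^2}{\tau p_{\rm ul}\sum_k\bar\beta_{n,m,k}+1},$$ and for every unicast user $u$ the following hold. (i) Under MR precoding all $\mathrm{UI}_{u,u'}$ and $\mathrm{MI}_{u,m}$ are square-integrable and $$\mathrm{SINR}_u^{\rm MR}=\frac{\big(\sqrt{p_{\rm dl}}\,L\sum_n a_{n,u}\sqrt{\eta_{n,u}}\,\gamma_{n,u}\big)^2}{p_{\rm dl}\big(L\sum_{u'}\sum_n a_{n,u'}\eta_{n,u'}\beta_{n,u}\gamma_{n,u'}+L\sum_m\sum_n\bar a_{n,m}\bar\eta_{n,m}\beta_{n,u}\zeta_{n,m}\big)+1}.$$ (ii)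 If $L>U+M$, then under ZF precoding every $\hat{\mathbf G}_n^H\hat{\mathbf G}_n$ is almost surely invertible, all $\mathrm{UI}_{u,u'}$ and $\mathrm{MI}_{u,m}$ are square-integrable and $$\mathrm{SINR}_u^{\rm ZF}=\frac{\big(\sqrt{p_{\rm dl}}\sum_n a_{n,u}\sqrt{\eta_{n,u}}\big)^2}{p_{\rm dl}\Big(\sum_{u'}\sum_n a_{n,u'}\eta_{n,u'}\frac{\beta_{n,u}-\gamma_{n,u}}{(L-U-M)\gamma_{n,u'}}+\sum_m\sum_n\bar a_{n,m}\bar\eta_{n,m}\frac{\beta_{n,u}-\gamma_{n,u}}{(L-U-M)\zeta_{n,m}}\Big)+1}.$$ -/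

import Mathlib

open MeasureTheory ProbabilityTheory Matrix
open scoped NNReal

noncomputable section

namespace CellFree

/-- The circularly symmetric complex Gaussian law `CN(0,1)`: independent real and imaginary
parts, each centred Gaussian with variance `1/2`. -/
def stdComplexGaussian : Measure ℂ :=
  ((gaussianReal 0 (1 / 2 : ℝ≥0)).prod (gaussianReal 0 (1 / 2 : ℝ≥0))).map
    (fun z : ℝ × ℝ => (z.1 : ℂ) + (z.2 : ℂ) * Complex.I)

/-- The deterministic data of the system: `N` access points with `L` antennas each, `U` unicast
users, `M` multicast groups (group `m` has `K m` users), pilots of length `τ`. -/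
structure System (N L U M : ℕ) (K : Fin M → ℕ) (τ : ℕ) where
  /-- normalized uplink (pilot) transmit power -/
  pul : ℝ
  /-- maximum normalized downlink transmit power of an access point -/
  pdl : ℝ
  /-- large-scale fading coefficients of the unicast users -/
  β : Fin N → Fin U → ℝ
  /-- large-scale fading coefficients of the multicast users -/
  βbar : Fin N → (m : Fin M) → Fin (K m) → ℝ
  /-- one pilot per unicast user (`Sum.inl u`) and one per multicast group (`Sum.inr m`) -/
  pilot : Fin U ⊕ Fin M → Fin τ → ℂ
  /-- association of access points with unicast users -/
  a : Fin N → Fin U → ℝ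
  /-- association of access points with multicast groups -/
  abar : Fin N → Fin M → ℝ
  /-- power control coefficients of the unicast users -/
  η : Fin N → Fin U → ℝ
  /-- power control coefficients of the multicast groups -/
  ηbar : Fin N → Fin M → ℝ
  pul_pos : 0 < pul
  pdl_nonneg : 0 ≤ pdl
  β_pos : ∀ n u, 0 < β n u
  βbar_pos : ∀ n m k, 0 < βbar n m k
  group_nonempty : ∀ m, 0 < K m
  pilot_orthonormal : ∀ i j, star (pilot i) ⬝ᵥ pilot j = if i = j then 1 else 0
  a_binary : ∀ n u, a n u = 0 ∨ a n u = 1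
  abar_binary : ∀ n m, abar n m = 0 ∨ abar n m = 1
  η_nonneg : ∀ n u, 0 ≤ η n u
  ηbar_nonneg : ∀ n m, 0 ≤ ηbar n m

/-- The random data: small-scale fading vectors of the unicast users (`h`) and of the multicast
users (`hbar`), and the receiver noise during uplink training (`Ψ`). -/
structure Randomness (N L U M : ℕ) (K : Fin M → ℕ) (τ : ℕ) (Ω : Type*) where
  h : Fin N → Fin U → Fin L → Ω → ℂ
  hbar : Fin N → (m : Fin M) → Fin (K m) → Fin L → Ω → ℂ
  Ψ : Fin N → Fin L → Fin τ → Ω → ℂ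

variable {N L U M : ℕ} {K : Fin M → ℕ} {τ : ℕ} {Ω : Type*}

/-- The family of all scalar random variables of the model. -/
def Randomness.entry (R : Randomness N L U M K τ Ω) :
    (Fin N × Fin U × Fin L) ⊕ (Fin N × (Σ m : Fin M, Fin (K m)) × Fin L) ⊕
      (Fin N × Fin L × Fin τ) → Ω → ℂ
  | Sum.inl (n, u, l) => R.h n u l
  | Sum.inr (Sum.inl (n, j, l)) => R.hbar n j.1 j.2 l
  | Sum.inr (Sum.inr (n, l, s)) => R.Ψ n l s

/-- Independent Rayleigh fading and white Gaussian noise: all entries are independent `CN(0,1)`. -/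
structure Randomness.IsRayleigh [MeasurableSpace Ω] (R : Randomness N L U M K τ Ω)
    (P : Measure Ω) : Prop where
  law : ∀ i, HasLaw (R.entry i) stdComplexGaussian P
  indep : iIndepFun R.entry P

/-- The correlation matrix `E{x yᴴ}`. -/
def corr [MeasurableSpace Ω] {κ : Type*} (P : Measure Ω) (x y : Ω → κ → ℂ) : Matrix κ κ ℂ :=
  Matrix.of fun i j => ∫ ω, x ω i * star (y ω j) ∂P

/-- The MMSE estimate `E{x yᴴ} (E{y yᴴ})⁻¹ y` of `x` from the observation `y`. -/
def mmse [MeasurableSpace Ω] (P : Measure Ω) (x y : Ω → Fin L → ℂ) (ω : Ω) : Fin L → ℂ :=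
  (corr P x y * (corr P y y)⁻¹) *ᵥ y ω

/-- Maximum-ratio or zero-forcing precoding. -/
inductive Precoding
  | MR
  | ZF

namespace System

/-- The channel `c_{n,u} = β_{n,u}^{1/2} h_{n,u}` of a unicast user. -/
def c (S : System N L U M K τ) (R : Randomness N L U M K τ Ω) (n : Fin N) (u : Fin U) (ω : Ω) :
    Fin L → ℂ :=
  fun l => (√(S.β n u) : ℂ) * R.h n u l ω

/-- The channel `t_{n,m,k} = β̄_{n,m,k}^{1/2} h_{n,m,k}` of a multicast user. -/
def t (S : System N L U M K τ) (R : Randomness N L U M K τ Ω) (n : Fin N) (m : Fin M)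
    (k : Fin (K m)) (ω : Ω) : Fin L → ℂ :=
  fun l => (√(S.βbar n m k) : ℂ) * R.hbar n m k l ω

/-- The signal `Y_{n,p}` received at access point `n` during uplink training. -/
def Y (S : System N L U M K τ) (R : Randomness N L U M K τ Ω) (n : Fin N) (ω : Ω) :
    Matrix (Fin L) (Fin τ) ℂ :=
  (√(τ * S.pul) : ℂ) • ∑ u, vecMulVec (S.c R n u ω) (star (S.pilot (Sum.inl u))) +
  (√(τ * S.pul) : ℂ) • ∑ m, ∑ k, vecMulVec (S.t R n m k ω) (star (S.pilot (Sum.inr m))) +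
  Matrix.of fun l s => R.Ψ n l s ω

/-- The projection of the received training signal onto a pilot. -/
def y (S : System N L U M K τ) (R : Randomness N L U M K τ Ω) (n : Fin N) (i : Fin U ⊕ Fin M)
    (ω : Ω) : Fin L → ℂ :=
  S.Y R n ω *ᵥ S.pilot i

variable [MeasurableSpace Ω]

/-- The local MMSE estimate `ĉ_{n,u}`. -/
def chat (S : System N L U M K τ) (R : Randomness N L U M K τ Ω) (P : Measure Ω) (n : Fin N)
    (u : Fin U) (ω : Ω) : Fin L → ℂ :=
  mmse P (S.c R n u) (S.y R n (Sum.inl u)) ω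

/-- The channel estimate `t̂_{n,m} = ∑ₖ t̂_{n,m,k}` of a multicast group, the sum of the local
MMSE estimates of the channels of its users. -/
def that (S : System N L U M K τ) (R : Randomness N L U M K τ Ω) (P : Measure Ω) (n : Fin N)
    (m : Fin M) (ω : Ω) : Fin L → ℂ :=
  ∑ k, mmse P (S.t R n m k) (S.y R n (Sum.inr m)) ω

/-- The matrix `Ĝ_n = [ĉ_{n,1}, …, ĉ_{n,U}, t̂_{n,1}, …, t̂_{n,M}]`. -/
def Ghat (S : System N L U M K τ) (R : Randomness N L U M K τ Ω) (P : Measure Ω) (n : Fin N)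
    (ω : Ω) : Matrix (Fin L) (Fin U ⊕ Fin M) ℂ :=
  Matrix.of fun l => Sum.elim (fun u => S.chat R P n u ω l) (fun m => S.that R P n m ω l)

/-- The precoding vector of a unicast user. -/
def b (S : System N L U M K τ) (R : Randomness N L U M K τ Ω) (P : Measure Ω) (ς : Precoding)
    (n : Fin N) (u : Fin U) (ω : Ω) : Fin L → ℂ :=
  match ς with
  | .MR => S.chat R P n u ω
  | .ZF => (S.Ghat R P n ω * ((S.Ghat R P n ω)ᴴ * S.Ghat R P n ω)⁻¹) *ᵥ
      Pi.single (Sum.inl u) 1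

/-- The precoding vector of a multicast group. -/
def bbar (S : System N L U M K τ) (R : Randomness N L U M K τ Ω) (P : Measure Ω) (ς : Precoding)
    (n : Fin N) (m : Fin M) (ω : Ω) : Fin L → ℂ :=
  match ς with
  | .MR => S.that R P n m ω
  | .ZF => (S.Ghat R P n ω * ((S.Ghat R P n ω)ᴴ * S.Ghat R P n ω)⁻¹) *ᵥ
      Pi.single (Sum.inr m) 1

/-- The gain of the symbol of unicast user `u'` at unicast user `u`; for `u' ≠ u` it is the
inter-user interference. -/
def UI (S : System N L U M K τ) (R : Randomness N L U M K τ Ω) (P : Measure Ω) (ς : Precoding)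
    (u u' : Fin U) (ω : Ω) : ℂ :=
  (√S.pdl : ℂ) * ∑ n, (S.a n u' : ℂ) * (√(S.η n u') : ℂ) *
    (star (S.c R n u ω) ⬝ᵥ S.b R P ς n u' ω)

/-- The interference at unicast user `u` from the symbol of multicast group `m`. -/
def MI (S : System N L U M K τ) (R : Randomness N L U M K τ Ω) (P : Measure Ω) (ς : Precoding)
    (u : Fin U) (m : Fin M) (ω : Ω) : ℂ :=
  (√S.pdl : ℂ) * ∑ n, (S.abar n m : ℂ) * (√(S.ηbar n m) : ℂ) *
    (star (S.c R n u ω) ⬝ᵥ S.bbar R P ς n m ω)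

/-- The desired signal `DS_u`. -/
def DS (S : System N L U M K τ) (R : Randomness N L U M K τ Ω) (P : Measure Ω) (ς : Precoding)
    (u : Fin U) : ℂ :=
  (√S.pdl : ℂ) * ∫ ω, ∑ n, (S.a n u : ℂ) * (√(S.η n u) : ℂ) *
    (star (S.c R n u ω) ⬝ᵥ S.b R P ς n u ω) ∂P

/-- The beamforming uncertainty `BU_u`. -/
def BU (S : System N L U M K τ) (R : Randomness N L U M K τ Ω) (P : Measure Ω) (ς : Precoding)
    (u : Fin U) (ω : Ω) : ℂ :=
  S.UI R P ς u u ω - ∫ ω', S.UI R P ς u u ω' ∂P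

/-- The use-and-then-forget downlink SINR of unicast user `u`. -/
def SINR (S : System N L U M K τ) (R : Randomness N L U M K τ Ω) (P : Measure Ω) (ς : Precoding)
    (u : Fin U) : ℝ :=
  ‖S.DS R P ς u‖ ^ 2 /
    (∫ ω, ‖S.BU R P ς u ω‖ ^ 2 ∂P +
      ∑ u' ∈ Finset.univ.erase u, ∫ ω, ‖S.UI R P ς u u' ω‖ ^ 2 ∂P +
      ∑ m, ∫ ω, ‖S.MI R P ς u m ω‖ ^ 2 ∂P + 1)

/-- The variance `γ_{n,u}` of the estimated channel of a unicast user. -/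
def γ (S : System N L U M K τ) (n : Fin N) (u : Fin U) : ℝ :=
  τ * S.pul * S.β n u ^ 2 / (τ * S.pul * S.β n u + 1)

/-- The mean square `ζ_{n,m}` of the channel estimate of a multicast group. -/
def ζ (S : System N L U M K τ) (n : Fin N) (m : Fin M) : ℝ :=
  (√(τ * S.pul) * ∑ k, S.βbar n m k) ^ 2 / (τ * S.pul * ∑ k, S.βbar n m k + 1)

end System

end CellFree

end

noncomputable section

namespace CellFree

/-! Every channel, training observation and estimate is a linear image of a single vector of
independent `CN(0,1)` entries, so all second-order statistics are Gram products of coefficient rows.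
Orthonormal pilots decouple the observations. Each MMSE estimate is therefore a scalar multiple of
its observation, with variance `γ` or `ζ`, and the estimation error of a user is orthogonal to all
observations. After normalization, the rows of the errors of user `u` and of all estimates are
orthonormal. Since `CN(0,1)` vectors are unitarily invariant (`hasLaw_dotProduct_iidGaussian`),
errors and estimates together are again independent `CN(0,1)` (`hasLaw_errEst`), and `c = √γ g + √(β
- γ) e` with `e` independent of every estimate (`c_eq`).

Both precoders depend on the estimates only. Each signal at user `u` is thus a constant (nonzero at
most for its own symbol) plus a centred fluctuation `A(z) + ∑ conj(e_p) C_p(z)`, with `e` white and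
independent of `z`, so mean squares add (`integral_norm_sq_add_sum_star_mul`).

For MR, `A` is a sum of centred products of estimates, each of unit variance whether or not the two
indices agree. The estimate part contributes `γ` and the error part `β - γ`, together `β`.

For ZF, `Ĝᴴ Ĝ(ĜᴴĜ)⁻¹ = 1` makes the estimate part deterministic, so only the error remains, weighted
by the mean squared norm of a column of the ZF matrix. That squared norm is the inverse squared
length of the projection of one estimate onto the orthogonal complement of the others
(`sum_norm_sq_zfMatrix`). Given the others, this length squared is `Gamma(L - U - M + 1, 1)`, whose
inverse has mean `1 / (L - U - M)` (`lintegral_sum_norm_sq_zfMatrix`).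

`SINR_of_signal` turns such decompositions into the SINR, the beamforming uncertainty supplying the
term `u' = u` of the interference sum. -/

/-! ### The scalar law `CN(0,1)`: density, moments, transforms. -/

open Complex in
lemma stdComplexGaussian_eq_withDensity :
    stdComplexGaussian =
      (volume : Measure ℂ).withDensity fun z => ENNReal.ofReal (Real.pi⁻¹ * Real.exp (-‖z‖ ^ 2)) := by
  have hv : (1 / 2 : ℝ≥0) ≠ 0 := by norm_num
  have hfun : (fun z : ℝ × ℝ => (z.1 : ℂ) + (z.2 : ℂ) * I) = measurableEquivRealProd.symm := by
    ext z
    simp [measurableEquivRealProd_symm_apply, Complex.mk_eq_add_mul_I]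
  rw [stdComplexGaussian, gaussianReal_of_var_ne_zero _ hv, prod_withDensity
    (measurable_gaussianPDF _ _) (measurable_gaussianPDF _ _), hfun]
  have hvol : (volume : Measure ℂ) =
      ((volume : Measure ℝ).prod volume).map measurableEquivRealProd.symm :=
    (volume_preserving_equiv_real_prod.symm measurableEquivRealProd).map_eq.symm
  have hd : Measurable fun z : ℂ => ENNReal.ofReal (Real.pi⁻¹ * Real.exp (-‖z‖ ^ 2)) := by fun_prop
  have hd' : Measurable fun z : ℝ × ℝ =>
      gaussianPDF 0 (1 / 2 : ℝ≥0) z.1 * gaussianPDF 0 (1 / 2 : ℝ≥0) z.2 := by fun_prop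
  ext s hs
  rw [Measure.map_apply measurableEquivRealProd.symm.measurable hs,
    withDensity_apply _ (measurableEquivRealProd.symm.measurable hs), withDensity_apply _ hs, hvol,
    setLIntegral_map hs hd measurableEquivRealProd.symm.measurable]
  refine lintegral_congr fun z => ?_
  rw [gaussianPDF, gaussianPDF, ← ENNReal.ofReal_mul (gaussianPDFReal_nonneg _ _ _)]
  congr 1
  simp only [gaussianPDFReal, measurableEquivRealProd_symm_apply]
  rw [mul_mul_mul_comm, ← Real.exp_add, Complex.sq_norm, Complex.normSq_apply, ← mul_inv,
    Real.mul_self_sqrt (by positivity)]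
  have : (2 * Real.pi * ((1 / 2 : ℝ≥0) : ℝ)) = Real.pi := by push_cast; ring
  rw [this]
  congr 2
  push_cast
  ring

instance : IsProbabilityMeasure stdComplexGaussian :=
  Measure.isProbabilityMeasure_map (by fun_prop)

lemma integral_stdComplexGaussian {E : Type*} [NormedAddCommGroup E] [NormedSpace ℝ E]
    (f : ℂ → E) :
    ∫ z, f z ∂stdComplexGaussian = ∫ z, (Real.pi⁻¹ * Real.exp (-‖z‖ ^ 2)) • f z := by
  rw [stdComplexGaussian_eq_withDensity, integral_withDensity_eq_integral_toReal_smul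
    (by fun_prop) (by simp)]
  refine integral_congr_ae (.of_forall fun z => ?_)
  simp only
  rw [ENNReal.toReal_ofReal (by positivity)]

instance : NullSingletonClass stdComplexGaussian := by
  rw [stdComplexGaussian_eq_withDensity]
  infer_instance

lemma integral_norm_pow_stdComplexGaussian (k : ℕ) :
    ∫ z, ‖z‖ ^ (2 * k) ∂stdComplexGaussian = k.factorial := by
  rw [integral_stdComplexGaussian]
  have h := Complex.integral_rpow_mul_exp_neg_rpow (p := 2) (q := (2 * k : ℕ)) (by norm_num)
    (by have : (0 : ℝ) ≤ (2 * k : ℕ) := by positivity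
        linarith)
  have h2 : (((2 * k : ℕ) : ℝ) + 2) / 2 = k + 1 := by push_cast; ring
  rw [h2, Real.Gamma_nat_eq_factorial] at h
  simp only [Real.rpow_natCast, Real.rpow_two] at h
  simp only [smul_eq_mul, mul_assoc]
  rw [integral_const_mul]
  simp_rw [mul_comm (Real.exp _)]
  rw [h]
  field_simp

/-- `‖z‖²` is exponential with mean one; its Laplace transform feeds the computation of the inverse
Gamma mean. -/
lemma integral_exp_neg_mul_sq_stdComplexGaussian {s : ℝ} (hs : 0 ≤ s) :
    ∫ z, Real.exp (-s * ‖z‖ ^ 2) ∂stdComplexGaussian = (1 + s)⁻¹ := by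
  rw [integral_stdComplexGaussian]
  have h := Complex.integral_exp_neg_mul_rpow (p := 2) (b := 1 + s) (by norm_num) (by linarith)
  simp only [Real.rpow_two, smul_eq_mul, mul_assoc] at h ⊢
  rw [integral_const_mul]
  simp_rw [← Real.exp_add]
  have h3 : ∀ z : ℂ, -‖z‖ ^ 2 + -s * ‖z‖ ^ 2 = -(1 + s) * ‖z‖ ^ 2 := fun z => by ring
  simp_rw [h3]
  rw [h]
  norm_num [Real.rpow_neg_one]

lemma integrable_norm_pow_stdComplexGaussian (k : ℕ) :
    Integrable (fun z : ℂ => ‖z‖ ^ (2 * k)) stdComplexGaussian := by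
  -- The Bochner integral of a non-integrable function is `0`, whereas this one equals `k! ≠ 0`.
  refine not_imp_comm.1 integral_undef ?_
  rw [integral_norm_pow_stdComplexGaussian]
  exact_mod_cast k.factorial_ne_zero

/-- The exponent 4 makes products of two coordinates square-integrable, as MR signals require. -/
lemma memLp_id_stdComplexGaussian : MemLp id 4 stdComplexGaussian := by
  have := integrable_norm_pow_stdComplexGaussian 2
  have h := (integrable_norm_rpow_iff (μ := stdComplexGaussian) (f := (id : ℂ → ℂ)) (p := 4)
    (by fun_prop) (by simp) (by simp)).1
  apply h
  convert this using 2
  simp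

lemma integral_id_stdComplexGaussian : ∫ z, z ∂stdComplexGaussian = 0 := by
  rw [integral_stdComplexGaussian]
  -- The integrand is odd.
  have := integral_neg_eq_self (μ := (volume : Measure ℂ))
    (fun z : ℂ => (Real.pi⁻¹ * Real.exp (-‖z‖ ^ 2)) • z)
  simp only [norm_neg, smul_neg, integral_neg] at this
  exact self_eq_neg.1 this.symm

/-- Dependence on `‖t‖` alone is the source of unitary invariance; the 4 is `2 / (1/2)`, each real
component having variance `1/2`. -/
lemma charFun_stdComplexGaussian (t : ℂ) :
    charFun stdComplexGaussian t = Complex.exp (-(‖t‖ ^ 2 / 4 : ℝ)) := by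
  rw [stdComplexGaussian, charFun_apply, integral_map (by fun_prop) (by fun_prop)]
  have h : ∀ z : ℝ × ℝ,
      Complex.exp ((inner ℝ ((z.1 : ℂ) + (z.2 : ℂ) * Complex.I) t : ℝ) * Complex.I) =
        Complex.exp ((z.1 * t.re : ℝ) * Complex.I) * Complex.exp ((z.2 * t.im : ℝ) * Complex.I) := by
    intro z
    rw [← Complex.exp_add, Complex.inner]
    congr 1
    simp
    ring
  simp_rw [h]
  rw [integral_prod_mul (fun x : ℝ => Complex.exp ((x * t.re : ℝ) * Complex.I))
    (fun x : ℝ => Complex.exp ((x * t.im : ℝ) * Complex.I))]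
  have h2 : ∀ a : ℝ, ∫ x : ℝ, Complex.exp ((x * a : ℝ) * Complex.I) ∂(gaussianReal 0 (1 / 2 : ℝ≥0)) =
      Complex.exp (-(a ^ 2 / 4 : ℝ)) := by
    intro a
    have := charFun_gaussianReal (μ := 0) (v := 1 / 2) a
    rw [charFun_apply_real] at this
    rw [show (-(a ^ 2 / 4 : ℝ) : ℂ) = a * (0 : ℝ) * Complex.I - ((1 / 2 : ℝ≥0) : ℂ) * a ^ 2 / 2 by
      push_cast; ring, ← this]
    refine integral_congr_ae (.of_forall fun x => ?_)
    simp only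
    congr 1
    push_cast
    ring
  rw [h2, h2, ← Complex.exp_add, Complex.sq_norm, Complex.normSq_apply]
  congr 1
  push_cast
  ring

/-- The law of a family of independent `CN(0,1)` variables indexed by `ι`. -/
abbrev iidGaussian (ι : Type*) [Fintype ι] : Measure (ι → ℂ) :=
  Measure.pi fun _ => stdComplexGaussian

/-! ### Vectors of independent `CN(0,1)` coordinates and their unitary invariance. -/

section iid

variable {ι : Type*} [Fintype ι]

lemma iIndepFun_eval_iidGaussian : iIndepFun (fun (i : ι) (z : ι → ℂ) => z i) (iidGaussian ι) :=
  iIndepFun_pi (X := fun _ z => z) fun _ => aemeasurable_id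

lemma memLp_eval_iidGaussian (i : ι) : MemLp (fun z : ι → ℂ => z i) 4 (iidGaussian ι) :=
  memLp_id_stdComplexGaussian.comp_measurePreserving (measurePreserving_eval _ i)

lemma memLp_two_eval_iidGaussian (i : ι) : MemLp (fun z : ι → ℂ => z i) 2 (iidGaussian ι) :=
  (memLp_eval_iidGaussian i).mono_exponent (by norm_num)

lemma integral_eval_iidGaussian (i : ι) : ∫ z : ι → ℂ, z i ∂iidGaussian ι = 0 := by
  rw [integral_comp_eval (μ := fun _ : ι => stdComplexGaussian) (f := fun z : ℂ => z)
    (by fun_prop), integral_id_stdComplexGaussian]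

lemma integral_norm_sq_eval_iidGaussian (i : ι) : ∫ z : ι → ℂ, ‖z i‖ ^ 2 ∂iidGaussian ι = 1 := by
  rw [integral_comp_eval (μ := fun _ : ι => stdComplexGaussian) (f := fun z : ℂ => ‖z‖ ^ 2)
    (by fun_prop)]
  simpa using integral_norm_pow_stdComplexGaussian 1

lemma mul_star_eq_ofReal (x : ℂ) : x * star x = ((‖x‖ ^ 2 : ℝ) : ℂ) := by
  rw [Complex.star_def, Complex.mul_conj, Complex.normSq_eq_norm_sq]

lemma integral_mul_star_eval_iidGaussian [DecidableEq ι] (i j : ι) :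
    ∫ z : ι → ℂ, z i * star (z j) ∂iidGaussian ι = if i = j then 1 else 0 := by
  split_ifs with h
  · subst h
    simp_rw [mul_star_eq_ofReal]
    rw [integral_complex_ofReal, integral_norm_sq_eval_iidGaussian, Complex.ofReal_one]
  · have hi := (iIndepFun_eval_iidGaussian.indepFun h).comp measurable_id
      (ψ := fun z : ℂ => star z) continuous_star.measurable
    refine (hi.integral_fun_mul_eq_mul_integral
      (measurable_pi_apply i).aestronglyMeasurable
      (continuous_star.measurable.comp (measurable_pi_apply j)).aestronglyMeasurable).trans ?_
    simp [integral_eval_iidGaussian]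

lemma integrable_mul_star {Ω : Type*} [MeasurableSpace Ω] {P : Measure Ω} {X Y : Ω → ℂ}
    (hX : MemLp X 2 P) (hY : MemLp Y 2 P) : Integrable (fun ω => X ω * star (Y ω)) P :=
  hX.integrable_mul hY.star

lemma integral_dotProduct_mul_star_dotProduct (a b : ι → ℂ) :
    ∫ z : ι → ℂ, (a ⬝ᵥ z) * star (b ⬝ᵥ z) ∂iidGaussian ι = a ⬝ᵥ star b := by
  classical
  simp only [dotProduct, star_sum, Finset.sum_mul_sum, star_mul']
  have hint : ∀ i j : ι, Integrable (fun z : ι → ℂ => a i * z i * (star (b j) * star (z j)))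
      (iidGaussian ι) := by
    intro i j
    have := ((integrable_mul_star (memLp_two_eval_iidGaussian i)
      (memLp_two_eval_iidGaussian j)).const_mul (a i * star (b j)))
    exact this.congr (.of_forall fun z => by simp only; ring)
  rw [integral_finsetSum _ fun i _ => integrable_finsetSum _ fun j _ => hint i j]
  refine Finset.sum_congr rfl fun i _ => ?_
  rw [integral_finsetSum _ fun j _ => hint i j, Finset.sum_eq_single i]
  · rw [← mul_one (a i * star b i)]
    have := integral_mul_star_eval_iidGaussian i i
    rw [if_pos rfl] at this
    rw [← this, ← integral_const_mul]
    exact integral_congr_ae (.of_forall fun z => by simp only [Pi.star_apply]; ring)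
  · intro j _ hj
    have := integral_mul_star_eval_iidGaussian i j
    rw [if_neg hj.symm] at this
    rw [← mul_zero (a i * star (b j)), ← this, ← integral_const_mul]
    exact integral_congr_ae (.of_forall fun z => by simp only; ring)
  · simp

/-- A matrix with orthonormal rows maps independent `CN(0,1)` variables to independent `CN(0,1)`
variables. -/
lemma hasLaw_dotProduct_iidGaussian {κ : Type*} [Fintype κ] [DecidableEq κ] (A : κ → ι → ℂ)
    (hA : ∀ j k, A j ⬝ᵥ star (A k) = if j = k then 1 else 0) :
    HasLaw (fun (z : ι → ℂ) j => A j ⬝ᵥ z) (iidGaussian κ) (iidGaussian ι) := by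
  have hmeas : Measurable fun (z : ι → ℂ) j => A j ⬝ᵥ z := by
    unfold dotProduct; fun_prop
  refine ⟨hmeas.aemeasurable, ?_⟩
  have : IsProbabilityMeasure ((iidGaussian ι).map fun (z : ι → ℂ) j => A j ⬝ᵥ z) :=
    Measure.isProbabilityMeasure_map hmeas.aemeasurable
  -- The characteristic function of the image at `t` is that of the source at `Aᴴ t`. Both are
  -- functions of the Euclidean norm only, and orthonormal rows give `‖Aᴴ t‖ = ‖t‖`.
  refine charFun_eq_pi_iff.1 fun t => ?_
  have hpi := charFun_pi (μ := fun _ : ι => stdComplexGaussian)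
    (WithLp.toLp 2 fun i => ∑ j, star (A j i) * t j)
  have hnorm : ∑ i, ‖∑ j, star (A j i) * t j‖ ^ 2 = ∑ j, ‖t j‖ ^ 2 := by
    have h1 : ∑ i, (∑ j, star (A j i) * t j) * star (∑ k, star (A k i) * t k) =
        ∑ j, t j * star (t j) := by
      simp only [star_sum, Finset.sum_mul_sum, star_mul', star_star]
      rw [Finset.sum_comm]
      refine Finset.sum_congr rfl fun j _ => ?_
      rw [Finset.sum_comm, Finset.sum_eq_single j]
      · have := hA j j
        rw [if_pos rfl, dotProduct] at this
        rw [← mul_one (t j * star (t j)), ← this, Finset.mul_sum]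
        exact Finset.sum_congr rfl fun i _ => by simp only [Pi.star_apply]; ring
      · intro k _ hk
        have := hA k j
        rw [if_neg hk, dotProduct] at this
        rw [← mul_zero (t j * star (t k)), ← this, Finset.mul_sum]
        exact Finset.sum_congr rfl fun i _ => by simp only [Pi.star_apply]; ring
      · simp
    simp_rw [mul_star_eq_ofReal] at h1
    exact_mod_cast h1
  have hL : charFun (((iidGaussian ι).map fun (z : ι → ℂ) j => A j ⬝ᵥ z).map (WithLp.toLp 2)) t =
      charFun ((iidGaussian ι).map (WithLp.toLp 2))
        (WithLp.toLp 2 fun i => ∑ j, star (A j i) * t j) := by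
    rw [charFun_apply, charFun_apply, integral_map (by fun_prop) (by fun_prop),
      integral_map (by fun_prop) (by fun_prop), integral_map (by fun_prop) (by fun_prop)]
    refine integral_congr_ae (.of_forall fun z => ?_)
    simp only [PiLp.inner_apply, Complex.inner, dotProduct]
    congr 3
    simp only [map_sum, map_mul, Finset.sum_mul, Finset.mul_sum, Complex.re_sum]
    rw [Finset.sum_comm]
    refine Finset.sum_congr rfl fun i _ => Finset.sum_congr rfl fun j _ => ?_
    rw [Complex.star_def]
    congr 1
    ring
  rw [hL, hpi]
  simp only [charFun_stdComplexGaussian]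
  rw [← Complex.exp_sum, ← Complex.exp_sum]
  congr 1
  simp only [Finset.sum_neg_distrib]
  rw [← Complex.ofReal_sum, ← Complex.ofReal_sum, ← Finset.sum_div, ← Finset.sum_div, hnorm]

end iid

lemma integral_norm_sq_sum_of_orthogonal {Ω ι : Type*} [MeasurableSpace Ω] {P : Measure Ω}
    (s : Finset ι) {X : ι → Ω → ℂ} (hX : ∀ i ∈ s, MemLp (X i) 2 P)
    (h : ∀ i ∈ s, ∀ j ∈ s, i ≠ j → ∫ ω, X i ω * star (X j ω) ∂P = 0) :
    ∫ ω, ‖∑ i ∈ s, X i ω‖ ^ 2 ∂P = ∑ i ∈ s, ∫ ω, ‖X i ω‖ ^ 2 ∂P := by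
  have hc : ∫ ω, (∑ i ∈ s, X i ω) * star (∑ i ∈ s, X i ω) ∂P =
      ∑ i ∈ s, ∫ ω, X i ω * star (X i ω) ∂P := by
    simp only [star_sum, Finset.sum_mul_sum]
    rw [integral_finsetSum _ fun i hi => integrable_finsetSum _ fun j hj =>
      integrable_mul_star (hX i hi) (hX j hj)]
    refine Finset.sum_congr rfl fun i hi => ?_
    rw [integral_finsetSum _ fun j hj => integrable_mul_star (hX i hi) (hX j hj)]
    exact Finset.sum_eq_single_of_mem i hi fun j hj hij => h i hi j hj hij.symm
  simp_rw [mul_star_eq_ofReal, integral_complex_ofReal] at hc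
  exact_mod_cast hc

/-! ### The mean of an inverse Gamma variable. -/

/-- Writing `1/S` as a Laplace integral reduces its mean to Laplace transforms. In `ENNReal` the
identity survives at `S = 0`, where both sides are `∞`, so no null set has to be removed. -/
lemma lintegral_exp_neg_mul_Ioi {S : ℝ} (hS : 0 ≤ S) :
    ∫⁻ s in Set.Ioi (0 : ℝ), ENNReal.ofReal (Real.exp (-s * S)) = (ENNReal.ofReal S)⁻¹ := by
  rcases hS.eq_or_lt with rfl | hS
  · simp
  · rw [← ofReal_integral_eq_lintegral_ofReal _ (.of_forall fun s => (Real.exp_pos _).le)]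
    · simp_rw [show ∀ s : ℝ, -s * S = -S * s from fun s => by ring]
      rw [integral_exp_mul_Ioi (by linarith), ← ENNReal.ofReal_inv_of_pos hS]
      congr 1
      simp [neg_div_neg_eq]
    · simp_rw [show ∀ s : ℝ, -s * S = -S * s from fun s => by ring]
      exact integrableOn_exp_mul_Ioi (by linarith) 0

/-- The exponent is at least 2 because `∫ (1 + s)⁻¹` diverges, just as `1/‖z‖²` has infinite mean
for a single coordinate. -/
lemma lintegral_one_add_inv_pow_Ioi (d : ℕ) :
    ∫⁻ s in Set.Ioi (0 : ℝ), ENNReal.ofReal ((1 + s)⁻¹ ^ (d + 2)) =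
      ENNReal.ofReal ((d : ℝ) + 1)⁻¹ := by
  have hd : ∀ x ∈ Set.Ici (0 : ℝ), HasDerivAt (fun s : ℝ => -((d : ℝ) + 1)⁻¹ * (1 + s)⁻¹ ^ (d + 1))
      ((1 + x)⁻¹ ^ (d + 2)) x := by
    intro x hx
    have hx' : (0 : ℝ) < 1 + x := by have := Set.mem_Ici.1 hx; linarith
    have h1 : HasDerivAt (fun s : ℝ => (1 + s)⁻¹) (-1 / (1 + x) ^ 2) x :=
      ((hasDerivAt_id x).const_add 1).inv hx'.ne'
    refine ((h1.pow (d + 1)).const_mul (-((d : ℝ) + 1)⁻¹)).congr_deriv ?_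
    have : (d : ℝ) + 1 ≠ 0 := by positivity
    simp only [Nat.add_sub_cancel, Nat.cast_add, Nat.cast_one, inv_pow]
    field_simp
    ring
  have hpos : ∀ x ∈ Set.Ioi (0 : ℝ), 0 ≤ (1 + x)⁻¹ ^ (d + 2) := by
    intro x hx
    have := Set.mem_Ioi.1 hx
    positivity
  have hlim : Filter.Tendsto (fun s : ℝ => -((d : ℝ) + 1)⁻¹ * (1 + s)⁻¹ ^ (d + 1)) Filter.atTop
      (nhds 0) := by
    have h1 : Filter.Tendsto (fun s : ℝ => (1 + s)⁻¹) Filter.atTop (nhds 0) :=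
      tendsto_inv_atTop_zero.comp (Filter.tendsto_atTop_add_const_left _ 1 Filter.tendsto_id)
    simpa using (h1.pow (d + 1)).const_mul (-((d : ℝ) + 1)⁻¹)
  rw [← ofReal_integral_eq_lintegral_ofReal
    (integrableOn_Ioi_deriv_of_nonneg' hd hpos hlim)
    ((ae_restrict_iff' measurableSet_Ioi).2 (.of_forall hpos)),
    integral_Ioi_of_hasDerivAt_of_nonneg' hd hpos hlim]
  simp

/-- The inverse of a `Gamma(d + 2, 1)` variable has mean `1 / (d + 1)`. -/
lemma lintegral_inv_sum_norm_sq_iidGaussian {ι : Type*} [Fintype ι] {d : ℕ}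
    (hd : Fintype.card ι = d + 2) :
    ∫⁻ z : ι → ℂ, (ENNReal.ofReal (∑ i, ‖z i‖ ^ 2))⁻¹ ∂iidGaussian ι =
      ENNReal.ofReal ((d : ℝ) + 1)⁻¹ := by
  have h0 : ∀ z : ι → ℂ, 0 ≤ ∑ i, ‖z i‖ ^ 2 := fun z => by positivity
  -- Tonelli moves the expectation inside; independence then factors it into `(1 + s)⁻¹` to the
  -- number of coordinates.
  rw [lintegral_congr fun z : ι → ℂ => (lintegral_exp_neg_mul_Ioi (h0 z)).symm,
    lintegral_lintegral_swap (by fun_prop), ← lintegral_one_add_inv_pow_Ioi]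
  refine setLIntegral_congr_fun measurableSet_Ioi fun s hs => ?_
  have hs' : (0 : ℝ) ≤ s := (Set.mem_Ioi.1 hs).le
  rw [← ofReal_integral_eq_lintegral_ofReal _ (.of_forall fun s => (Real.exp_pos _).le)]
  · simp_rw [Finset.mul_sum, Real.exp_sum]
    rw [integral_fintype_prod_eq_pow (fun z : ℂ => Real.exp (-s * ‖z‖ ^ 2)),
      integral_exp_neg_mul_sq_stdComplexGaussian hs', hd]
  · refine Integrable.of_bound (C := 1) (Measurable.aestronglyMeasurable (by fun_prop)) (.of_forall fun z => ?_)
    rw [Real.norm_eq_abs, Real.abs_exp, Real.exp_le_one_iff]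
    nlinarith [h0 z]

/-! ### Resampling one coordinate of a product measure. -/

section splitting

variable {κ : Type*} [Fintype κ] [DecidableEq κ] {X : κ → Type*} [∀ i, MeasurableSpace (X i)]
  {μ : ∀ i, Measure (X i)} [∀ i, IsProbabilityMeasure (μ i)]

/-- This is the form of conditioning used below: all columns but one are frozen and that one is
integrated first. Working with `Function.update` avoids reindexing the product as a pair. -/
lemma lintegral_pi_update (i : κ) {f : (∀ i, X i) → ENNReal} (hf : Measurable f) :
    ∫⁻ x, f x ∂Measure.pi μ = ∫⁻ x, ∫⁻ y, f (Function.update x i y) ∂μ i ∂Measure.pi μ := by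
  have hg : Measurable fun x => ∫⁻ y, f (Function.update x i y) ∂μ i :=
    (hf.comp measurable_update').lintegral_prod_right'
  have : Nonempty (∀ i, X i) := ⟨fun i => (nonempty_of_isProbabilityMeasure (μ i)).some⟩
  obtain ⟨x⟩ := this
  rw [lintegral_eq_lmarginal_univ x, lintegral_eq_lmarginal_univ x,
    lmarginal_erase' _ hf (Finset.mem_univ i), lmarginal_erase' _ hg (Finset.mem_univ i)]
  simp

/-- Fubini for null sets, by `lintegral_pi_update` applied to the indicator of the exceptional set;
the converse follows in the same way. -/
lemma ae_pi_of_ae_update (i : κ) {p : (∀ i, X i) → Prop} (hp : MeasurableSet {x | p x})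
    (h : ∀ᵐ x ∂Measure.pi μ, ∀ᵐ y ∂μ i, p (Function.update x i y)) : ∀ᵐ x ∂Measure.pi μ, p x := by
  have hm : Measurable ({x | p x}ᶜ.indicator (1 : (∀ i, X i) → ENNReal)) :=
    measurable_one.indicator hp.compl
  have hg : Measurable fun x => ∫⁻ y, ({x | p x}ᶜ.indicator (1 : (∀ i, X i) → ENNReal))
      (Function.update x i y) ∂μ i :=
    (hm.comp measurable_update').lintegral_prod_right'
  change Measure.pi μ {x | p x}ᶜ = 0
  rw [← lintegral_indicator_one hp.compl]
  refine (lintegral_pi_update i hm).trans ?_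
  rw [lintegral_eq_zero_iff hg]
  filter_upwards [h] with x hx
  refine lintegral_eq_zero_of_ae_eq_zero ?_
  filter_upwards [hx] with y hy
  simp [hy]

lemma ae_update_of_ae_pi (i : κ) {p : (∀ i, X i) → Prop} (hp : MeasurableSet {x | p x})
    (h : ∀ᵐ x ∂Measure.pi μ, p x) : ∀ᵐ x ∂Measure.pi μ, ∀ᵐ y ∂μ i, p (Function.update x i y) := by
  have hm : Measurable ({x | p x}ᶜ.indicator (1 : (∀ i, X i) → ENNReal)) :=
    measurable_one.indicator hp.compl
  have hg : Measurable fun x => ∫⁻ y, ({x | p x}ᶜ.indicator (1 : (∀ i, X i) → ENNReal))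
      (Function.update x i y) ∂μ i :=
    (hm.comp measurable_update').lintegral_prod_right'
  change Measure.pi μ {x | p x}ᶜ = 0 at h
  rw [← lintegral_indicator_one hp.compl] at h
  have h2 := (lintegral_pi_update i hm).symm.trans h
  rw [lintegral_eq_zero_iff hg] at h2
  filter_upwards [h2] with x hx
  have h3 := (lintegral_eq_zero_iff (hm.comp (measurable_update x))).1 hx
  filter_upwards [h3] with y hy
  by_contra hn
  simp [hn] at hy

end splitting

/-! ### Geometry of the zero-forcing matrix. -/

section linearAlgebra

variable {ι κ : Type*} [Fintype ι] [Fintype κ] [DecidableEq κ]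

/-- The zero-forcing matrix `G (Gᴴ G)⁻¹`. -/
def zfMatrix (G : Matrix ι κ ℂ) : Matrix ι κ ℂ :=
  G * (Gᴴ * G)⁻¹

/-- The matrix with the given columns. -/
def ofCols (x : κ → ι → ℂ) : Matrix ι κ ℂ :=
  Matrix.of fun l i => x i l

open scoped ComplexOrder in
lemma isUnit_gram_ofCols {x : κ → ι → ℂ} (hx : LinearIndependent ℂ x) :
    IsUnit ((ofCols x)ᴴ * ofCols x) := by
  have h : LinearIndependent ℂ (ofCols x).col := hx
  have h2 := Matrix.PosDef.conjTranspose_mul_self (ofCols x) (Matrix.mulVec_injective_iff.2 h)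
  exact h2.isUnit

lemma conjTranspose_mul_zfMatrix {G : Matrix ι κ ℂ} (hG : IsUnit (Gᴴ * G)) :
    Gᴴ * zfMatrix G = 1 := by
  rw [zfMatrix, ← Matrix.mul_assoc, Matrix.mul_nonsing_inv _ ((Matrix.isUnit_iff_isUnit_det _).1 hG)]

/-- Allows the columns to be normalized to unit variance. Invertibility of the Gram matrix is not
needed, as `Matrix.mul_inv_rev` also holds for the default value of the inverse. -/
lemma zfMatrix_mul_diagonal (G : Matrix ι κ ℂ) {d : κ → ℝ} (hd : ∀ i, d i ≠ 0) :
    zfMatrix (G * diagonal fun i => (d i : ℂ)) = zfMatrix G * diagonal fun i => (d i : ℂ)⁻¹ := by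
  have hD : IsUnit (diagonal fun i => (d i : ℂ)).det := by
    rw [Matrix.det_diagonal, isUnit_iff_ne_zero]
    exact Finset.prod_ne_zero_iff.2 fun i _ => by exact_mod_cast hd i
  have hinv : (diagonal fun i => (d i : ℂ))⁻¹ = diagonal fun i => (d i : ℂ)⁻¹ := by
    refine Matrix.inv_eq_right_inv ?_
    rw [Matrix.diagonal_mul_diagonal, ← Matrix.diagonal_one]
    congr 1
    ext i
    exact mul_inv_cancel₀ (by exact_mod_cast hd i)
  have hH : (diagonal fun i => (d i : ℂ))ᴴ = diagonal fun i => (d i : ℂ) := by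
    rw [Matrix.diagonal_conjTranspose]
    congr 1
    ext i
    simp
  rw [zfMatrix, zfMatrix, Matrix.conjTranspose_mul, hH, Matrix.mul_assoc (diagonal _),
    ← Matrix.mul_assoc Gᴴ, Matrix.mul_inv_rev, Matrix.mul_inv_rev, Matrix.mul_assoc G,
    ← Matrix.mul_assoc (diagonal _), ← Matrix.mul_assoc (diagonal _),
    Matrix.mul_nonsing_inv _ hD, Matrix.one_mul, hinv, Matrix.mul_assoc]

/-- By Cramer's rule the inverse is `det⁻¹` times the adjugate, both continuous in the entries
before the scalar inversion, which is measurable. -/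
lemma measurable_zfMatrix_ofCols (l : ι) (j : κ) :
    Measurable fun x : κ → ι → ℂ => zfMatrix (ofCols x) l j := by
  have hG : Measurable fun x : κ → ι → ℂ => ((ofCols x)ᴴ * ofCols x).det := by
    refine Continuous.measurable ?_
    unfold ofCols
    fun_prop
  have hA : ∀ i, Measurable fun x : κ → ι → ℂ => ((ofCols x)ᴴ * ofCols x).adjugate i j := by
    intro i
    refine Continuous.measurable ?_
    unfold ofCols
    fun_prop
  have hsum : ∀ x : κ → ι → ℂ, zfMatrix (ofCols x) l j = ∑ i, ofCols x l i *
      (((ofCols x)ᴴ * ofCols x).det⁻¹ * ((ofCols x)ᴴ * ofCols x).adjugate i j) := by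
    intro x
    rw [zfMatrix, Matrix.mul_apply, Matrix.inv_def, Ring.inverse_eq_inv']
    rfl
  simp_rw [hsum]
  refine Finset.measurable_sum _ fun i _ => ?_
  have : Measurable fun x : κ → ι → ℂ => ofCols x l i := by
    unfold ofCols
    simp only [Matrix.of_apply]
    fun_prop
  exact this.mul (hG.inv.mul (hA i))

/-- The span of all columns but one. -/
def otherSpan (x : κ → ι → ℂ) (j : κ) : Submodule ℂ (EuclideanSpace ℂ ι) :=
  Submodule.span ℂ (Set.range fun i : {i // i ≠ j} => WithLp.toLp 2 (x i))

-- Hence `complBasis` stays fixed while column `j` is resampled.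
omit [Fintype ι] [Fintype κ] in
lemma otherSpan_update (x : κ → ι → ℂ) (j : κ) (y : ι → ℂ) :
    otherSpan (Function.update x j y) j = otherSpan x j := by
  unfold otherSpan
  congr 2
  ext i : 1
  rw [Function.update_of_ne i.2]

/-- An orthonormal basis of the orthogonal complement of a subspace. -/
def complBasis (W : Submodule ℂ (EuclideanSpace ℂ ι)) :
    OrthonormalBasis (Fin (Module.finrank ℂ Wᗮ)) ℂ Wᗮ :=
  stdOrthonormalBasis ℂ Wᗮ

/-- The `+ 1` appears because only the other columns span; the additive form avoids truncated
subtraction. -/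
lemma finrank_otherSpan_orthogonal {x : κ → ι → ℂ} (hx : LinearIndependent ℂ x) (j : κ) :
    Module.finrank ℂ (otherSpan x j)ᗮ + Fintype.card κ = Fintype.card ι + 1 := by
  have h1 : Module.finrank ℂ (otherSpan x j) = Fintype.card {i // i ≠ j} := by
    refine finrank_span_eq_card ?_
    have h2 : LinearIndependent ℂ fun i => (WithLp.linearEquiv 2 ℂ (ι → ℂ)).symm (x i) :=
      hx.map' _ (LinearEquiv.ker _)
    exact h2.comp _ Subtype.val_injective
  have h3 := Submodule.finrank_add_finrank_orthogonal (otherSpan x j)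
  rw [finrank_euclideanSpace, h1, Fintype.card_subtype_compl, Fintype.card_subtype_eq] at h3
  have : 0 < Fintype.card κ := Fintype.card_pos_iff.2 ⟨j⟩
  omega

/-- Column `j`, called `b`, is the dual vector: `⟨x i, b⟩ = δ_ij` with `b = ∑ c i • x i`. It is
orthogonal to the other columns, so it is `c j` times the projection of `x j` onto their complement,
and `‖b‖² = ‖c j‖² S` with `S` the squared length of that projection. Also `⟨b, b⟩ = conj (c j)`, so
`‖c j‖ = ‖b‖²`, and the two relations give `‖b‖² S = 1`. -/
lemma sum_norm_sq_zfMatrix {x : κ → ι → ℂ} (hx : LinearIndependent ℂ x) (j : κ) :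
    0 < ∑ k, ‖inner ℂ (complBasis (otherSpan x j) k : EuclideanSpace ℂ ι) (WithLp.toLp 2 (x j))‖ ^ 2 ∧
      ∑ l, ‖zfMatrix (ofCols x) l j‖ ^ 2 =
        (∑ k, ‖inner ℂ (complBasis (otherSpan x j) k : EuclideanSpace ℂ ι) (WithLp.toLp 2 (x j))‖ ^ 2)⁻¹ := by
  set b : EuclideanSpace ℂ ι := WithLp.toLp 2 fun l => zfMatrix (ofCols x) l j with hb
  set c : κ → ℂ := fun i => ((ofCols x)ᴴ * ofCols x)⁻¹ i j with hc
  have hG := conjTranspose_mul_zfMatrix (isUnit_gram_ofCols hx)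
  have hin : ∀ i, inner ℂ (WithLp.toLp 2 (x i)) b = if i = j then 1 else 0 := by
    intro i
    have := congrFun (congrFun hG i) j
    rw [Matrix.one_apply, Matrix.mul_apply] at this
    rw [← this, PiLp.inner_apply]
    refine Finset.sum_congr rfl fun l _ => ?_
    simp [hb, ofCols, mul_comm]
  have hbsum : b = ∑ i, c i • WithLp.toLp 2 (x i) := by
    ext l
    simp [hb, hc, zfMatrix, Matrix.mul_apply, ofCols, mul_comm]
  have hbV : b ∈ (otherSpan x j)ᗮ := by
    rw [otherSpan, Submodule.mem_orthogonal]
    intro v hv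
    induction hv using Submodule.span_induction with
    | mem v hv =>
      obtain ⟨i, rfl⟩ := hv
      simp [hin, i.2]
    | zero => simp
    | add v w _ _ hv hw => rw [inner_add_left, hv, hw, add_zero]
    | smul a v _ hv => rw [inner_smul_left, hv, mul_zero]
  have hcoord : ∀ k, inner ℂ (complBasis (otherSpan x j) k : EuclideanSpace ℂ ι) b =
      c j * inner ℂ (complBasis (otherSpan x j) k : EuclideanSpace ℂ ι) (WithLp.toLp 2 (x j)) := by
    intro k
    rw [hbsum, inner_sum, Finset.sum_eq_single j, inner_smul_right]
    · intro i _ hi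
      rw [inner_smul_right]
      have : WithLp.toLp 2 (x i) ∈ otherSpan x j := Submodule.subset_span ⟨⟨i, hi⟩, rfl⟩
      rw [Submodule.inner_left_of_mem_orthogonal this (complBasis (otherSpan x j) k).2, mul_zero]
    · simp
  have hnb : ∑ k, ‖inner ℂ (complBasis (otherSpan x j) k : EuclideanSpace ℂ ι) b‖ ^ 2 = ‖b‖ ^ 2 := by
    have := (complBasis (otherSpan x j)).sum_sq_norm_inner_right ⟨b, hbV⟩
    simpa using this
  simp_rw [hcoord, norm_mul, mul_pow] at hnb
  rw [← Finset.mul_sum] at hnb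
  have hself : inner ℂ b b = star (c j) := by
    conv_lhs => rw [hbsum]
    rw [sum_inner, Finset.sum_eq_single j]
    · rw [← hbsum, inner_smul_left, hin]
      simp
    · intro i _ hi
      rw [← hbsum, inner_smul_left, hin, if_neg hi, mul_zero]
    · simp
  have hcb : ‖c j‖ = ‖b‖ ^ 2 := by
    rw [← norm_star, ← hself, inner_self_eq_norm_sq_to_K]
    simp
  have hb0 : 0 < ‖b‖ ^ 2 := by
    have : b ≠ 0 := by
      intro h0
      have := hin j
      rw [h0] at this
      simp at this
    positivity
  have hN : ∑ l, ‖zfMatrix (ofCols x) l j‖ ^ 2 = ‖b‖ ^ 2 := by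
    rw [EuclideanSpace.norm_sq_eq]
  rw [hN]
  rw [hcb] at hnb
  set S := ∑ k, ‖inner ℂ (complBasis (otherSpan x j) k : EuclideanSpace ℂ ι) (WithLp.toLp 2 (x j))‖ ^ 2
  have h1 : ‖b‖ ^ 2 * S = 1 := by
    have : ‖b‖ ^ 2 * (‖b‖ ^ 2 * S) = ‖b‖ ^ 2 * 1 := by rw [mul_one]; nlinarith
    exact mul_left_cancel₀ hb0.ne' this
  exact ⟨pos_of_mul_pos_right (h1 ▸ one_pos) hb0.le, eq_inv_of_mul_eq_one_left h1⟩

end linearAlgebra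

/-! ### Almost sure linear independence and the inverse Wishart mean. -/

section independence

variable {ι κ : Type*} [Fintype ι] [Fintype κ] [DecidableEq κ]

/-- A proper subspace lies in the kernel of a nonzero functional. Normalized, this functional is
`CN(0,1)` distributed, a law without an atom at `0`. -/
lemma ae_notMem_submodule [DecidableEq ι] {W : Submodule ℂ (ι → ℂ)} (hW : W ≠ ⊤) :
    ∀ᵐ y ∂iidGaussian ι, y ∉ W := by
  obtain ⟨f, hf0, hfW⟩ := Submodule.exists_le_ker_of_lt_top W (lt_top_iff_ne_top.2 hW)
  set a : ι → ℂ := fun l => f (Pi.single l 1) with ha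
  have hfa : ∀ y, f y = a ⬝ᵥ y := by
    intro y
    rw [LinearMap.pi_apply_eq_sum_univ f y, dotProduct]
    refine Finset.sum_congr rfl fun l _ => ?_
    rw [smul_eq_mul, mul_comm, ha]
    congr 2
    ext m
    simp [Pi.single_apply, eq_comm]
  have ha0 : 0 < ∑ l, ‖a l‖ ^ 2 := by
    refine lt_of_le_of_ne (by positivity) fun h => hf0 ?_
    have h0 : ∀ l, a l = 0 := fun l => by
      simpa using (Finset.sum_eq_zero_iff_of_nonneg (fun l _ => by positivity)).1 h.symm l
        (Finset.mem_univ l)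
    ext y
    simp [hfa, dotProduct, h0]
  set r : ℝ := √(∑ l, ‖a l‖ ^ 2) with hr
  have hr0 : (r : ℂ) ≠ 0 := by exact_mod_cast (Real.sqrt_pos.2 ha0).ne'
  have hlaw := hasLaw_dotProduct_iidGaussian (fun (_ : Unit) l => (r : ℂ)⁻¹ * a l) (by
    intro _ _
    have h1 : ∑ l, a l * star (a l) = (r : ℂ) ^ 2 := by
      simp_rw [mul_star_eq_ofReal]
      rw [← Complex.ofReal_sum, ← Complex.ofReal_pow, hr, Real.sq_sqrt ha0.le]
    simp only [dotProduct, Pi.star_apply, star_mul', if_true]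
    calc ∑ l, (r : ℂ)⁻¹ * a l * (star (r : ℂ)⁻¹ * star (a l))
        = (r : ℂ)⁻¹ ^ 2 * ∑ l, a l * star (a l) := by
          rw [Finset.mul_sum]
          refine Finset.sum_congr rfl fun l _ => ?_
          have : star (r : ℂ)⁻¹ = (r : ℂ)⁻¹ := by simp
          rw [this]
          ring
      _ = 1 := by rw [h1]; field_simp)
  have h2 : ∀ᵐ z ∂iidGaussian Unit, z () ≠ 0 := by
    have := (measurePreserving_eval (fun _ : Unit => stdComplexGaussian) ()).quasiMeasurePreserving.ae
      (p := fun z => z ≠ 0) (by simp [ae_iff])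
    exact this
  have h3 := ae_of_ae_map hlaw.aemeasurable (hlaw.map_eq.symm ▸ h2)
  filter_upwards [h3] with y hy hyW
  refine hy ?_
  have : a ⬝ᵥ y = 0 := by rw [← hfa]; exact hfW hyW
  simp only [dotProduct, mul_assoc] at this ⊢
  rw [← Finset.mul_sum, this, mul_zero]

omit [DecidableEq κ] in
lemma measurableSet_linearIndepOn (s : Finset κ) :
    MeasurableSet {x : κ → ι → ℂ | LinearIndepOn ℂ x (s : Set κ)} := by
  have h : IsOpen {f : s → ι → ℂ | LinearIndependent ℂ f} := isOpen_setOfPred_linearIndependent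
  exact h.measurableSet.preimage
    (f := fun (x : κ → ι → ℂ) (i : s) => x i) (by fun_prop)

/-- Induction on the columns: a new column almost surely avoids the span of the earlier ones, which
has too small a dimension to be everything. Using sets of columns of one matrix keeps the sample
space fixed. -/
lemma ae_linearIndepOn (s : Finset κ) (hs : s.card ≤ Fintype.card ι) :
    ∀ᵐ x ∂Measure.pi fun _ : κ => iidGaussian ι, LinearIndepOn ℂ x (s : Set κ) := by
  classical
  induction s using Finset.induction_on with
  | empty => simp
  | insert j s hj ih =>
    rw [Finset.card_insert_of_notMem hj] at hs
    refine ae_pi_of_ae_update j (measurableSet_linearIndepOn _) ?_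
    filter_upwards [ih (by omega)] with x hx
    have hW : Submodule.span ℂ (x '' (s : Set κ)) ≠ ⊤ := by
      intro h
      have h1 : Module.finrank ℂ (Submodule.span ℂ (x '' (s : Set κ))) ≤ s.card := by
        rw [← Finset.coe_image]
        exact (finrank_span_finset_le_card _).trans Finset.card_image_le
      rw [h, finrank_top, Module.finrank_fintype_fun_eq_card] at h1
      omega
    filter_upwards [ae_notMem_submodule hW] with y hy
    have heq : Set.EqOn (Function.update x j y) x (s : Set κ) := fun i hi =>
      Function.update_of_ne (by rintro rfl; exact hj hi) _ _
    rw [Finset.coe_insert]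
    refine LinearIndepOn.insert (hx.congr heq.symm) ?_
    rw [heq.image_eq, Function.update_self]
    exact hy

lemma ae_linearIndependent (h : Fintype.card κ ≤ Fintype.card ι) :
    ∀ᵐ x ∂Measure.pi fun _ : κ => iidGaussian ι, LinearIndependent ℂ x := by
  have := ae_linearIndepOn (ι := ι) (Finset.univ : Finset κ) h
  simpa [linearIndepOn_univ_iff] using this

omit [DecidableEq κ] in
lemma measurableSet_linearIndependent :
    MeasurableSet {x : κ → ι → ℂ | LinearIndependent ℂ x} :=
  isOpen_setOfPred_linearIndependent.measurableSet

/-- For frozen other columns, the coordinates of a fresh column in an orthonormal basis of the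
complement are `d + 2` independent `CN(0,1)` variables. -/
lemma lintegral_inv_sum_norm_sq_inner {x : κ → ι → ℂ} (hx : LinearIndependent ℂ x) (j : κ) {d : ℕ}
    (hd : Fintype.card ι = Fintype.card κ + d + 1) :
    ∫⁻ y : ι → ℂ, (ENNReal.ofReal (∑ k, ‖inner ℂ (complBasis (otherSpan x j) k : EuclideanSpace ℂ ι)
      (WithLp.toLp 2 y)‖ ^ 2))⁻¹ ∂iidGaussian ι = ENNReal.ofReal ((d : ℝ) + 1)⁻¹ := by
  have hlaw := hasLaw_dotProduct_iidGaussian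
    (fun k l => star ((complBasis (otherSpan x j) k : EuclideanSpace ℂ ι) l)) (by
      intro k k'
      have := orthonormal_iff_ite.1 (complBasis (otherSpan x j)).orthonormal k k'
      rw [← this, Submodule.coe_inner, PiLp.inner_apply, dotProduct]
      refine Finset.sum_congr rfl fun l _ => ?_
      simp [mul_comm])
  have hr := finrank_otherSpan_orthogonal hx j
  have hcard : Fintype.card (Fin (Module.finrank ℂ (otherSpan x j)ᗮ)) = d + 2 := by
    rw [Fintype.card_fin]; omega
  have hS : Measurable fun z : Fin (Module.finrank ℂ (otherSpan x j)ᗮ) → ℂ =>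
      (ENNReal.ofReal (∑ i, ‖z i‖ ^ 2))⁻¹ := by fun_prop
  rw [← lintegral_inv_sum_norm_sq_iidGaussian hcard, ← hlaw.lintegral_comp
    (Measurable.aemeasurable hS)]
  refine lintegral_congr fun y => ?_
  congr 3
  ext k
  congr 2
  simp only [PiLp.inner_apply, dotProduct]
  refine Finset.sum_congr rfl fun l _ => ?_
  simp [mul_comm]

/-- The mean of a diagonal entry of an inverse complex Wishart matrix. -/
lemma lintegral_sum_norm_sq_zfMatrix (j : κ) {d : ℕ}
    (hd : Fintype.card ι = Fintype.card κ + d + 1) :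
    ∫⁻ x, ENNReal.ofReal (∑ l, ‖zfMatrix (ofCols x) l j‖ ^ 2) ∂Measure.pi (fun _ : κ => iidGaussian ι) =
      ENNReal.ofReal ((d : ℝ) + 1)⁻¹ := by
  have hm : Measurable fun x : κ → ι → ℂ =>
      ENNReal.ofReal (∑ l, ‖zfMatrix (ofCols x) l j‖ ^ 2) :=
    (Finset.measurable_sum _ fun l _ => (measurable_zfMatrix_ofCols l j).norm.pow_const 2).ennreal_ofReal
  have hli := ae_linearIndependent (ι := ι) (κ := κ) (by omega)
  -- Condition on the columns other than `j`; the inner integral is then the same constant for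
  -- almost all of them.
  rw [lintegral_pi_update j hm]
  calc _ = ∫⁻ _ : κ → ι → ℂ, ENNReal.ofReal ((d : ℝ) + 1)⁻¹ ∂Measure.pi (fun _ : κ => iidGaussian ι) := by
        refine lintegral_congr_ae ?_
        filter_upwards [hli, ae_update_of_ae_pi j measurableSet_linearIndependent hli] with x hx hxy
        rw [← lintegral_inv_sum_norm_sq_inner hx j hd]
        refine lintegral_congr_ae ?_
        filter_upwards [hxy] with y hy
        obtain ⟨h1, h2⟩ := sum_norm_sq_zfMatrix hy j
        rw [h2, ENNReal.ofReal_inv_of_pos h1]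
        rw [otherSpan_update, Function.update_self]
    _ = _ := by simp

lemma memLp_zfMatrix (l : ι) (j : κ) (h : Fintype.card κ < Fintype.card ι) :
    MemLp (fun x => zfMatrix (ofCols x) l j) 2 (Measure.pi (fun _ : κ => iidGaussian ι)) := by
  obtain ⟨d, hd⟩ := Nat.exists_eq_add_of_lt h
  rw [memLp_two_iff_integrable_sq_norm (measurable_zfMatrix_ofCols l j).aestronglyMeasurable]
  refine ⟨((measurable_zfMatrix_ofCols l j).norm.pow_const 2).aestronglyMeasurable, ?_⟩
  rw [hasFiniteIntegral_iff_ofReal (.of_forall fun x => by positivity)]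
  refine lt_of_le_of_lt (lintegral_mono fun x => ?_) ((lintegral_sum_norm_sq_zfMatrix j hd).trans_lt
    ENNReal.ofReal_lt_top)
  exact ENNReal.ofReal_le_ofReal (Finset.single_le_sum
    (f := fun l => ‖zfMatrix (ofCols x) l j‖ ^ 2) (fun l _ => by positivity) (Finset.mem_univ l))

lemma sum_integral_norm_sq_zfMatrix (j : κ) (h : Fintype.card κ < Fintype.card ι) :
    ∑ l, ∫ x, ‖zfMatrix (ofCols x) l j‖ ^ 2 ∂Measure.pi (fun _ : κ => iidGaussian ι) =
      ((Fintype.card ι : ℝ) - Fintype.card κ)⁻¹ := by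
  obtain ⟨d, hd⟩ := Nat.exists_eq_add_of_lt h
  have hint : ∀ l ∈ Finset.univ, Integrable (fun x => ‖zfMatrix (ofCols x) l j‖ ^ 2)
      (Measure.pi (fun _ : κ => iidGaussian ι)) :=
    fun l _ => (memLp_zfMatrix l j h).integrable_norm_pow (by norm_num)
  rw [← integral_finsetSum _ hint, integral_eq_lintegral_of_nonneg_ae (.of_forall fun x => by positivity)
      (Finset.measurable_sum _ fun l _ =>
        (measurable_zfMatrix_ofCols l j).norm.pow_const 2).aestronglyMeasurable,
    lintegral_sum_norm_sq_zfMatrix j hd, ENNReal.toReal_ofReal (by positivity), hd]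
  push_cast
  congr 1
  ring

end independence

/-! ### Expressions conjugate-linear in errors that are independent of the estimates. -/

section fluctuation

lemma memLp_mul_prod {α β : Type*} [MeasurableSpace α] [MeasurableSpace β] {μ : Measure α}
    {ν : Measure β} [SFinite μ] [SFinite ν] {f : α → ℂ} {g : β → ℂ} (hf : MemLp f 2 μ)
    (hg : MemLp g 2 ν) : MemLp (fun z : α × β => f z.1 * g z.2) 2 (μ.prod ν) := by
  have hm : AEStronglyMeasurable (fun z : α × β => f z.1 * g z.2) (μ.prod ν) :=
    hf.1.comp_fst.mul hg.1.comp_snd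
  rw [memLp_two_iff_integrable_sq_norm hm]
  have := ((memLp_two_iff_integrable_sq_norm hf.1).1 hf).mul_prod
    ((memLp_two_iff_integrable_sq_norm hg.1).1 hg)
  refine this.congr (.of_forall fun z => ?_)
  simp only [norm_mul, mul_pow]

variable {T β : Type*} [Fintype T] [MeasurableSpace β] {μ : Measure β} [IsProbabilityMeasure μ]
  {A : β → ℂ} {C : T → β → ℂ}

lemma integral_star_eval_iidGaussian (p : T) : ∫ e : T → ℂ, star (e p) ∂iidGaussian T = 0 := by
  have h := integral_eval_iidGaussian p
  rw [← star_zero, ← h]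
  exact integral_conj

lemma memLp_star_eval_iidGaussian (p : T) :
    MemLp (fun e : T → ℂ => star (e p)) 2 (iidGaussian T) :=
  (memLp_two_eval_iidGaussian p).star

lemma memLp_add_sum_star_mul (hA : MemLp A 2 μ) (hC : ∀ p, MemLp (C p) 2 μ) :
    MemLp (fun x : (T → ℂ) × β => A x.2 + ∑ p, star (x.1 p) * C p x.2) 2
      ((iidGaussian T).prod μ) :=
  (hA.comp_measurePreserving measurePreserving_snd).add
    (memLp_finsetSum _ fun p _ => memLp_mul_prod (memLp_star_eval_iidGaussian p) (hC p))

lemma integral_add_sum_star_mul (hA : MemLp A 2 μ) (hC : ∀ p, MemLp (C p) 2 μ)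
    (hA0 : ∫ z, A z ∂μ = 0) :
    ∫ x : (T → ℂ) × β, (A x.2 + ∑ p, star (x.1 p) * C p x.2) ∂(iidGaussian T).prod μ = 0 := by
  have h1 : ∀ p, MemLp (fun x : (T → ℂ) × β => star (x.1 p) * C p x.2) 2 ((iidGaussian T).prod μ) :=
    fun p => memLp_mul_prod (memLp_star_eval_iidGaussian p) (hC p)
  have hA1 : Integrable (fun x : (T → ℂ) × β => A x.2) ((iidGaussian T).prod μ) :=
    (hA.comp_measurePreserving measurePreserving_snd).integrable (by norm_num)
  rw [integral_add hA1
    (integrable_finsetSum _ fun p _ => (h1 p).integrable (by norm_num)),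
    integral_finsetSum _ fun p _ => (h1 p).integrable (by norm_num)]
  have h2 : ∀ p, ∫ x : (T → ℂ) × β, star (x.1 p) * C p x.2 ∂(iidGaussian T).prod μ = 0 := by
    intro p
    rw [integral_prod_mul (fun e : T → ℂ => star (e p)) (C p), integral_star_eval_iidGaussian,
      zero_mul]
  simp only [h2, Finset.sum_const_zero, add_zero]
  rw [integral_fun_snd (f := A), hA0, smul_zero]

/-- The summands are pairwise orthogonal: by independence each cross term contains a factor `E e_p`,
its conjugate, or `E (e_q conj e_p)` with `p ≠ q`, all zero. -/
lemma integral_norm_sq_add_sum_star_mul (hA : MemLp A 2 μ) (hC : ∀ p, MemLp (C p) 2 μ) :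
    ∫ x : (T → ℂ) × β, ‖A x.2 + ∑ p, star (x.1 p) * C p x.2‖ ^ 2 ∂(iidGaussian T).prod μ =
      ∫ z, ‖A z‖ ^ 2 ∂μ + ∑ p, ∫ z, ‖C p z‖ ^ 2 ∂μ := by
  classical
  -- The index `none` carries the error-free term, so Pythagoras applies to a single family.
  let X : Option T → (T → ℂ) × β → ℂ := fun o x => o.elim (A x.2) fun p => star (x.1 p) * C p x.2
  have hX : ∀ o ∈ Finset.univ, MemLp (X o) 2 ((iidGaussian T).prod μ) := by
    rintro (_ | p) _
    · exact hA.comp_measurePreserving measurePreserving_snd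
    · exact memLp_mul_prod (memLp_star_eval_iidGaussian p) (hC p)
  have hns : ∀ p, ∫ x, X none x * star (X (some p) x) ∂(iidGaussian T).prod μ = 0 := by
    intro p
    have h := integral_prod_mul (μ := iidGaussian T) (ν := μ) (fun e : T → ℂ => e p)
      (fun z => A z * star (C p z))
    rw [integral_eval_iidGaussian, zero_mul] at h
    rw [← h]
    refine integral_congr_ae (.of_forall fun x => ?_)
    simp only [X, Option.elim_none, Option.elim_some, star_mul', star_star]
    ring
  have horth : ∀ o ∈ Finset.univ, ∀ o' ∈ Finset.univ, o ≠ o' →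
      ∫ x, X o x * star (X o' x) ∂(iidGaussian T).prod μ = 0 := by
    rintro (_ | p) _ (_ | q) _ hne
    · exact absurd rfl hne
    · exact hns q
    · have h := congrArg star (hns p)
      rw [star_zero] at h
      rw [← h]
      refine Eq.trans ?_ integral_conj
      refine integral_congr_ae (.of_forall fun x => ?_)
      simp [mul_comm]
    · have hpq : q ≠ p := fun h => hne (by rw [h])
      have h := integral_prod_mul (μ := iidGaussian T) (ν := μ)
        (fun e : T → ℂ => e q * star (e p)) (fun z => C p z * star (C q z))
      rw [integral_mul_star_eval_iidGaussian, if_neg hpq, zero_mul] at h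
      rw [← h]
      refine integral_congr_ae (.of_forall fun x => ?_)
      simp only [X, Option.elim_some, star_mul', star_star]
      ring
  have h := integral_norm_sq_sum_of_orthogonal Finset.univ hX horth
  simp only [Fintype.sum_option] at h
  refine h.trans ?_
  congr 1
  · exact (integral_fun_snd (f := fun z => ‖A z‖ ^ 2)).trans (by simp)
  · refine Finset.sum_congr rfl fun p _ => ?_
    have h := integral_prod_mul (μ := iidGaussian T) (ν := μ) (fun e : T → ℂ => ‖e p‖ ^ 2)
      (fun z => ‖C p z‖ ^ 2)
    rw [integral_norm_sq_eval_iidGaussian, one_mul] at h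
    rw [← h]
    refine integral_congr_ae (.of_forall fun x => ?_)
    simp only [X, Option.elim_some, norm_mul, norm_star, mul_pow]

end fluctuation

/-! ### Centred products of two coordinates. -/

section products

variable {J : Type*} [Fintype J] [DecidableEq J]

/-- The centred product of two coordinates. -/
def centredProduct (a b : J) (z : J → ℂ) : ℂ :=
  star (z a) * z b - if a = b then 1 else 0

lemma memLp_centredProduct (a b : J) : MemLp (centredProduct a b) 2 (iidGaussian J) := by
  have : ENNReal.HolderTriple 4 4 2 := ⟨by
    rw [← two_mul, show (4 : ENNReal) = 2 * 2 by norm_num,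
      ENNReal.mul_inv (by norm_num) (by norm_num), ← mul_assoc,
      ENNReal.mul_inv_cancel (by norm_num) (by norm_num), one_mul]⟩
  exact MemLp.sub (MemLp.mul (memLp_eval_iidGaussian b) (memLp_eval_iidGaussian a).star)
    (memLp_const _)

lemma integral_centredProduct (a b : J) : ∫ z, centredProduct a b z ∂iidGaussian J = 0 := by
  have h := integral_mul_star_eval_iidGaussian b a
  have hint := integrable_mul_star (memLp_two_eval_iidGaussian b) (memLp_two_eval_iidGaussian a)
  unfold centredProduct
  simp_rw [mul_comm (star _)]
  rw [integral_sub hint (integrable_const _), h]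
  simp [eq_comm]

/-- On the diagonal `E‖z‖⁴ - 2E‖z‖² + 1 = 2 - 2 + 1`, off the diagonal `E‖z_a‖² E‖z_b‖² = 1`. This
coincidence gives the beamforming uncertainty the same form as the interference. -/
lemma integral_norm_sq_centredProduct (a b : J) :
    ∫ z, ‖centredProduct a b z‖ ^ 2 ∂iidGaussian J = 1 := by
  unfold centredProduct
  split_ifs with h
  · subst h
    have h1 : ∀ z : J → ℂ, ‖star (z a) * z a - 1‖ ^ 2 = ‖z a‖ ^ (2 * 2) - 2 * ‖z a‖ ^ 2 + 1 := by
      intro z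
      rw [mul_comm, mul_star_eq_ofReal, ← Complex.ofReal_one, ← Complex.ofReal_sub,
        Complex.norm_real, Real.norm_eq_abs, sq_abs]
      ring
    simp_rw [h1]
    rw [integral_comp_eval (μ := fun _ : J => stdComplexGaussian)
      (f := fun z : ℂ => ‖z‖ ^ (2 * 2) - 2 * ‖z‖ ^ 2 + 1) (by fun_prop)]
    have h4 := integrable_norm_pow_stdComplexGaussian 2
    have h2 : Integrable (fun z : ℂ => ‖z‖ ^ 2) stdComplexGaussian := by
      simpa using integrable_norm_pow_stdComplexGaussian 1
    have i2 : ∫ z, ‖z‖ ^ 2 ∂stdComplexGaussian = 1 := by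
      simpa using integral_norm_pow_stdComplexGaussian 1
    have h42 : Integrable (fun z : ℂ => ‖z‖ ^ (2 * 2) - 2 * ‖z‖ ^ 2) stdComplexGaussian :=
      h4.sub (h2.const_mul 2)
    rw [integral_add h42 (integrable_const _),
      integral_sub h4 (h2.const_mul 2), integral_const_mul, integral_norm_pow_stdComplexGaussian, i2]
    norm_num [Nat.factorial]
  · have hi := (iIndepFun_eval_iidGaussian.indepFun h).comp
      (φ := fun z : ℂ => ‖z‖ ^ 2) (ψ := fun z : ℂ => ‖z‖ ^ 2) (by fun_prop) (by fun_prop)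
    have h3 := hi.integral_fun_mul_eq_mul_integral
      (Measurable.aestronglyMeasurable (by fun_prop)) (Measurable.aestronglyMeasurable (by fun_prop))
    simp only [sub_zero, norm_mul, norm_star, mul_pow]
    refine h3.trans ?_
    simp only [Function.comp_def, integral_norm_sq_eval_iidGaussian, mul_one]

omit [Fintype J] in
lemma measurable_centredProduct (a b : J) : Measurable (centredProduct a b) := by
  have h1 : Measurable fun z : J → ℂ => star (z a) :=
    continuous_star.measurable.comp (measurable_pi_apply a)
  have h2 : Measurable fun z : J → ℂ => z b := measurable_pi_apply b
  exact (h1.mul h2).sub_const _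

lemma integral_centredProduct_mul_star {a b a' b' : J} (h1 : a ≠ a') (h2 : a ≠ b') (h3 : b ≠ a')
    (h4 : b ≠ b') :
    ∫ z, centredProduct a b z * star (centredProduct a' b' z) ∂iidGaussian J = 0 := by
  have hst : Measurable (star : ℂ → ℂ) := continuous_star.measurable
  have hi := (iIndepFun_eval_iidGaussian.indepFun_prodMk_prodMk (fun i => measurable_pi_apply i)
    a b a' b' h1 h2 h3 h4).comp
    (φ := fun p : ℂ × ℂ => star p.1 * p.2 - if a = b then 1 else 0)
    (ψ := fun p : ℂ × ℂ => star (star p.1 * p.2 - if a' = b' then 1 else 0))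
    (((hst.comp measurable_fst).mul measurable_snd).sub_const _)
    (hst.comp (((hst.comp measurable_fst).mul measurable_snd).sub_const _))
  have h5 := hi.integral_fun_mul_eq_mul_integral
    (measurable_centredProduct a b).aestronglyMeasurable
    (hst.comp (measurable_centredProduct a' b')).aestronglyMeasurable
  refine h5.trans ?_
  have h6 := integral_centredProduct a b
  unfold centredProduct at h6
  simp only [Function.comp_def]
  rw [h6, zero_mul]

end products

/-! ### Fluctuations of MR and ZF signals in normalized variables. -/

section signals

variable {ν ι κ : Type*} [Fintype ν] [Fintype ι] [Fintype κ] [DecidableEq ν] [DecidableEq ι]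
  [DecidableEq κ]

/-- The law of the normalized channel estimates, indexed by access point, user or group, antenna,
together with the normalized estimation errors of one user. -/
abbrev errorEstimateLaw (ν ι κ : Type*) [Fintype ν] [Fintype ι] [Fintype κ] :
    Measure ((ν × ι → ℂ) × (ν × κ × ι → ℂ)) :=
  (iidGaussian (ν × ι)).prod (iidGaussian (ν × κ × ι))

/-- The part of the fluctuation of a maximum-ratio signal that depends on the estimates only. -/
def mrEstimatePart (u j : κ) (w : ν → ℂ) (z : ν × κ × ι → ℂ) : ℂ :=
  ∑ p : ν × ι, w p.1 * centredProduct (p.1, u, p.2) (p.1, j, p.2) z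

lemma memLp_mrEstimatePart (u j : κ) (w : ν → ℂ) :
    MemLp (mrEstimatePart (ι := ι) u j w) 2 (iidGaussian (ν × κ × ι)) :=
  memLp_finsetSum _ fun _ _ => (memLp_centredProduct _ _).const_mul _

lemma integral_mrEstimatePart (u j : κ) (w : ν → ℂ) :
    ∫ z, mrEstimatePart u j w z ∂iidGaussian (ν × κ × ι) = 0 := by
  unfold mrEstimatePart
  rw [integral_finsetSum _ fun p _ =>
    ((memLp_centredProduct _ _).const_mul _).integrable (by norm_num)]
  simp [integral_const_mul, integral_centredProduct]

lemma integral_norm_sq_mrEstimatePart (u j : κ) (w : ν → ℂ) :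
    ∫ z, ‖mrEstimatePart u j w z‖ ^ 2 ∂iidGaussian (ν × κ × ι) =
      Fintype.card ι * ∑ n, ‖w n‖ ^ 2 := by
  unfold mrEstimatePart
  rw [integral_norm_sq_sum_of_orthogonal Finset.univ
    (X := fun (p : ν × ι) (z : ν × κ × ι → ℂ) => w p.1 * centredProduct (p.1, u, p.2) (p.1, j, p.2) z)
    (fun p _ => (memLp_centredProduct _ _).const_mul _)]
  · simp only [norm_mul, mul_pow, integral_const_mul, integral_norm_sq_centredProduct, mul_one]
    rw [Fintype.sum_prod_type]
    simp [Finset.mul_sum]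
  · intro p _ q _ hpq
    -- Different pairs (access point, antenna) involve disjoint coordinates, even if `u = j`.
    have hne : ∀ i i' : κ, (p.1, i, p.2) ≠ (q.1, i', q.2) := by
      intro i i' h
      simp only [Prod.mk.injEq] at h
      exact hpq (Prod.ext h.1 h.2.2)
    have h := integral_centredProduct_mul_star (hne u u) (hne u j) (hne j u) (hne j j)
    rw [← mul_zero (w p.1 * star (w q.1)), ← h, ← integral_const_mul]
    refine integral_congr_ae (.of_forall fun z => ?_)
    simp only [star_mul']
    ring

/-- The fluctuation of a maximum-ratio signal around its mean. -/
def mrFluctuation (u j : κ) (w v : ν → ℂ) (x : (ν × ι → ℂ) × (ν × κ × ι → ℂ)) : ℂ :=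
  mrEstimatePart u j w x.2 + ∑ p : ν × ι, star (x.1 p) * (v p.1 * x.2 (p.1, j, p.2))

omit [DecidableEq ν] [DecidableEq ι] [DecidableEq κ] in
lemma memLp_const_mul_eval_iidGaussian (j : κ) (v : ν → ℂ) (p : ν × ι) :
    MemLp (fun z : ν × κ × ι → ℂ => v p.1 * z (p.1, j, p.2)) 2 (iidGaussian (ν × κ × ι)) :=
  (memLp_two_eval_iidGaussian (p.1, j, p.2)).const_mul _

lemma memLp_mrFluctuation (u j : κ) (w v : ν → ℂ) :
    MemLp (mrFluctuation (ι := ι) u j w v) 2 (errorEstimateLaw ν ι κ) := by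
  have h := memLp_add_sum_star_mul (memLp_mrEstimatePart u j w)
    (memLp_const_mul_eval_iidGaussian (ι := ι) j v)
  exact h

lemma integral_mrFluctuation (u j : κ) (w v : ν → ℂ) :
    ∫ x, mrFluctuation (ι := ι) u j w v x ∂errorEstimateLaw ν ι κ = 0 := by
  unfold mrFluctuation
  exact integral_add_sum_star_mul (memLp_mrEstimatePart u j w)
    (memLp_const_mul_eval_iidGaussian j v) (integral_mrEstimatePart u j w)

lemma integral_norm_sq_mrFluctuation (u j : κ) (w v : ν → ℂ) :
    ∫ x, ‖mrFluctuation (ι := ι) u j w v x‖ ^ 2 ∂errorEstimateLaw ν ι κ =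
      Fintype.card ι * ∑ n, (‖w n‖ ^ 2 + ‖v n‖ ^ 2) := by
  unfold mrFluctuation
  rw [integral_norm_sq_add_sum_star_mul (memLp_mrEstimatePart u j w)
    (memLp_const_mul_eval_iidGaussian j v), integral_norm_sq_mrEstimatePart,
    Finset.sum_add_distrib, mul_add, Fintype.sum_prod_type]
  simp [mul_pow, integral_const_mul, integral_norm_sq_eval_iidGaussian, Finset.mul_sum]

/-- The columns of estimates at one access point. -/
def estimateCols (n : ν) (z : ν × κ × ι → ℂ) : κ → ι → ℂ :=
  fun i l => z (n, i, l)

omit [DecidableEq ν] [DecidableEq ι] [DecidableEq κ] in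
lemma measurePreserving_estimateCols (n : ν) :
    MeasurePreserving (estimateCols n) (iidGaussian (ν × κ × ι))
      (Measure.pi fun _ : κ => iidGaussian ι) := by
  have h1 : HasLaw (fun (z : ν × κ × ι → ℂ) (q : κ × ι) => z (n, q)) (iidGaussian (κ × ι))
      (iidGaussian (ν × κ × ι)) :=
    (iIndepFun_eval_iidGaussian.precomp (g := fun q : κ × ι => (n, q))
      fun q q' h => (Prod.mk.inj h).2).hasLaw_pi
      fun q => (measurePreserving_eval (fun _ => stdComplexGaussian) (n, q)).hasLaw
  have h2 : MeasurePreserving (MeasurableEquiv.curry κ ι ℂ).symm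
      (Measure.pi fun _ : κ => iidGaussian ι) (iidGaussian (κ × ι)) := by
    refine ⟨(MeasurableEquiv.curry κ ι ℂ).symm.measurable, (Measure.pi_eq fun s hs => ?_).symm⟩
    rw [MeasurableEquiv.map_apply]
    have hpre : (MeasurableEquiv.curry κ ι ℂ).symm ⁻¹' Set.univ.pi s =
        Set.univ.pi fun i => Set.univ.pi fun l => s (i, l) := by
      ext x
      simp [MeasurableEquiv.coe_curry_symm, Function.uncurry]
    rw [hpre, Measure.pi_pi]
    simp_rw [Measure.pi_pi]
    rw [Fintype.prod_prod_type]
  have h3 := (h2.symm _).hasLaw.comp h1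
  refine h3.measurePreserving ?_
  exact (MeasurableEquiv.curry κ ι ℂ).measurable.comp (by fun_prop)

/-- The fluctuation of a zero-forcing signal around its mean. -/
def zfFluctuation (j : κ) (v : ν → ℂ) (x : (ν × ι → ℂ) × (ν × κ × ι → ℂ)) : ℂ :=
  -- The zero is the estimates-only part: under ZF it vanishes, and writing it keeps the common form
  -- `A + ∑ conj(e) C`.
  0 + ∑ p : ν × ι, star (x.1 p) * (v p.1 * zfMatrix (ofCols (estimateCols p.1 x.2)) p.2 j)

omit [DecidableEq ν] [DecidableEq ι] in
lemma memLp_const_mul_zfMatrix (h : Fintype.card κ < Fintype.card ι) (j : κ) (v : ν → ℂ)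
    (p : ν × ι) :
    MemLp (fun z : ν × κ × ι → ℂ => v p.1 * zfMatrix (ofCols (estimateCols p.1 z)) p.2 j) 2
      (iidGaussian (ν × κ × ι)) :=
  ((memLp_zfMatrix p.2 j h).comp_measurePreserving (measurePreserving_estimateCols p.1)).const_mul _

omit [DecidableEq ν] [DecidableEq ι] in
lemma memLp_zfFluctuation (h : Fintype.card κ < Fintype.card ι) (j : κ) (v : ν → ℂ) :
    MemLp (zfFluctuation (ι := ι) j v) 2 (errorEstimateLaw ν ι κ) := by
  have h := memLp_add_sum_star_mul (A := fun _ : ν × κ × ι → ℂ => 0) MemLp.zero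
    (memLp_const_mul_zfMatrix h j v)
  exact h

omit [DecidableEq ν] [DecidableEq ι] in
lemma integral_zfFluctuation (h : Fintype.card κ < Fintype.card ι) (j : κ) (v : ν → ℂ) :
    ∫ x, zfFluctuation (ι := ι) j v x ∂errorEstimateLaw ν ι κ = 0 := by
  unfold zfFluctuation
  exact integral_add_sum_star_mul (A := fun _ : ν × κ × ι → ℂ => 0) MemLp.zero
    (memLp_const_mul_zfMatrix h j v) (by simp)

-- Whiteness of the errors suffices: the ZF entries of different antennas are dependent, but only
-- the mean squared norm of a column enters.
omit [DecidableEq ν] [DecidableEq ι] in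
lemma integral_norm_sq_zfFluctuation (h : Fintype.card κ < Fintype.card ι) (j : κ) (v : ν → ℂ) :
    ∫ x, ‖zfFluctuation (ι := ι) j v x‖ ^ 2 ∂errorEstimateLaw ν ι κ =
      ∑ n, ‖v n‖ ^ 2 * ((Fintype.card ι : ℝ) - Fintype.card κ)⁻¹ := by
  unfold zfFluctuation
  rw [integral_norm_sq_add_sum_star_mul (A := fun _ : ν × κ × ι → ℂ => 0) MemLp.zero
    (memLp_const_mul_zfMatrix h j v)]
  have hl : ∀ (n : ν) (l : ι), ∫ z, ‖zfMatrix (ofCols (estimateCols n z)) l j‖ ^ 2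
      ∂iidGaussian (ν × κ × ι) =
      ∫ x, ‖zfMatrix (ofCols x) l j‖ ^ 2 ∂Measure.pi (fun _ : κ => iidGaussian ι) := fun n l => by
    rw [← (measurePreserving_estimateCols n).map_eq, integral_map
      (measurePreserving_estimateCols n).measurable.aemeasurable
      ((measurable_zfMatrix_ofCols l j).norm.pow_const 2).aestronglyMeasurable]
  simp only [norm_zero, norm_mul, mul_pow, integral_const_mul, hl]
  rw [Fintype.sum_prod_type]
  simp only [← Finset.mul_sum, sum_integral_norm_sq_zfMatrix j h]
  simp

end signals

/-! ### The model as one Gaussian vector. -/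

variable {N L U M : ℕ} {K : Fin M → ℕ} {τ : ℕ} {Ω : Type*}

/-- The index set of the scalar random variables of the model. -/
abbrev EntryIndex (N L U M : ℕ) (K : Fin M → ℕ) (τ : ℕ) : Type :=
  (Fin N × Fin U × Fin L) ⊕ (Fin N × (Σ m : Fin M, Fin (K m)) × Fin L) ⊕ (Fin N × Fin L × Fin τ)

/-- The vector of all scalar random variables of the model. -/
def Randomness.entries (R : Randomness N L U M K τ Ω) (ω : Ω) : EntryIndex N L U M K τ → ℂ :=
  fun i => R.entry i ω

lemma Randomness.IsRayleigh.hasLaw_entries [MeasurableSpace Ω] {P : Measure Ω}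
    {R : Randomness N L U M K τ Ω} (hR : R.IsRayleigh P) :
    HasLaw R.entries (iidGaussian (EntryIndex N L U M K τ)) P :=
  hR.indep.hasLaw_pi hR.law

lemma integral_entries_mul_star [MeasurableSpace Ω] {P : Measure Ω}
    {R : Randomness N L U M K τ Ω} (hR : R.IsRayleigh P) (a b : EntryIndex N L U M K τ → ℂ) :
    ∫ ω, (a ⬝ᵥ R.entries ω) * star (b ⬝ᵥ R.entries ω) ∂P = a ⬝ᵥ star b := by
  have hm : ∀ a : EntryIndex N L U M K τ → ℂ, Continuous fun z => a ⬝ᵥ z := fun a => by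
    unfold dotProduct; fun_prop
  rw [← integral_dotProduct_mul_star_dotProduct a b]
  exact hR.hasLaw_entries.integral_comp (f := fun z => (a ⬝ᵥ z) * star (b ⬝ᵥ z))
    ((hm a).mul (continuous_star.comp (hm b))).aestronglyMeasurable

lemma mmse_of_scalar_corr [MeasurableSpace Ω] {P : Measure Ω} {x y : Ω → Fin L → ℂ} {r q : ℂ}
    (hq : q ≠ 0) (hxy : corr P x y = r • (1 : Matrix (Fin L) (Fin L) ℂ))
    (hyy : corr P y y = q • (1 : Matrix (Fin L) (Fin L) ℂ)) (ω : Ω) (l : Fin L) :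
    mmse P x y ω l = r / q * y ω l := by
  have hinv : (q • (1 : Matrix (Fin L) (Fin L) ℂ))⁻¹ = q⁻¹ • (1 : Matrix (Fin L) (Fin L) ℂ) := by
    refine Matrix.inv_eq_right_inv ?_
    rw [Matrix.smul_mul, Matrix.mul_smul, Matrix.one_mul, smul_smul, mul_inv_cancel₀ hq, one_smul]
  rw [mmse, hxy, hyy, hinv, Matrix.smul_mul, Matrix.mul_smul, Matrix.one_mul, smul_smul,
    Matrix.smul_mulVec, Matrix.one_mulVec, Pi.smul_apply, smul_eq_mul, div_eq_mul_inv]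

/-! ### Coefficient rows and their Gram products. -/

namespace System

variable (S : System N L U M K τ)

/-- The pilot energy `τ p_ul`. -/
def pilotEnergy : ℝ := τ * S.pul

/-- The variance of the superposition of the channels that share a pilot. -/
def power (n : Fin N) : Fin U ⊕ Fin M → ℝ :=
  Sum.elim (S.β n) fun m => ∑ k, S.βbar n m k

/-- The variance of the projection of the training signal onto a pilot. -/
def obsVar (n : Fin N) (i : Fin U ⊕ Fin M) : ℝ := S.pilotEnergy * S.power n i + 1

/-- The variance of the channel estimate belonging to a pilot. -/
def estVar (n : Fin N) : Fin U ⊕ Fin M → ℝ := Sum.elim (S.γ n) (S.ζ n)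

/-- The coefficients of the channel of a multicast user. -/
def userRow (n : Fin N) (m : Fin M) (k : Fin (K m)) (l : Fin L) : EntryIndex N L U M K τ → ℂ :=
  Pi.single (Sum.inr (Sum.inl (n, ⟨m, k⟩, l))) (√(S.βbar n m k) : ℂ)

/-- The coefficients of the superposition of the channels that share a pilot. -/
def channelRow (n : Fin N) (i : Fin U ⊕ Fin M) (l : Fin L) : EntryIndex N L U M K τ → ℂ :=
  match i with
  | .inl u => Pi.single (Sum.inl (n, u, l)) (√(S.β n u) : ℂ)
  | .inr m => ∑ k, S.userRow n m k l

/-- The coefficients of the projection of the noise onto a pilot. -/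
def noiseRow (n : Fin N) (i : Fin U ⊕ Fin M) (l : Fin L) : EntryIndex N L U M K τ → ℂ :=
  Sum.elim 0 (Sum.elim 0 fun q => if q.1 = n ∧ q.2.1 = l then S.pilot i q.2.2 else 0)

/-- The coefficients of the projection of the training signal onto a pilot. -/
def obsRow (n : Fin N) (i : Fin U ⊕ Fin M) (l : Fin L) : EntryIndex N L U M K τ → ℂ :=
  ((√S.pilotEnergy : ℝ) : ℂ) • S.channelRow n i l + S.noiseRow n i l

/-- The index `i` supplies a unit vector of length `τ`, which excludes `τ = 0`. -/
lemma pilotEnergy_pos (i : Fin U ⊕ Fin M) : 0 < S.pilotEnergy := by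
  have hτ : τ ≠ 0 := by
    rintro rfl
    have := S.pilot_orthonormal i i
    simp [dotProduct] at this
  have := S.pul_pos
  have : (0 : ℝ) < τ := by exact_mod_cast Nat.pos_of_ne_zero hτ
  unfold pilotEnergy
  positivity

lemma power_pos (n : Fin N) (i : Fin U ⊕ Fin M) : 0 < S.power n i := by
  rcases i with u | m
  · exact S.β_pos n u
  · have : Nonempty (Fin (K m)) := ⟨⟨0, S.group_nonempty m⟩⟩
    exact Finset.sum_pos (fun k _ => S.βbar_pos n m k) Finset.univ_nonempty

lemma obsVar_pos (n : Fin N) (i : Fin U ⊕ Fin M) : 0 < S.obsVar n i := by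
  have := S.pilotEnergy_pos i
  have := S.power_pos n i
  unfold obsVar
  positivity

lemma estVar_eq (n : Fin N) (i : Fin U ⊕ Fin M) :
    S.estVar n i = S.pilotEnergy * S.power n i ^ 2 / S.obsVar n i := by
  rcases i with u | m
  · rfl
  · have h := (S.pilotEnergy_pos (.inr m)).le
    simp only [estVar, obsVar, power, Sum.elim_inr, ζ, pilotEnergy] at h ⊢
    rw [mul_pow, Real.sq_sqrt h]

lemma estVar_pos (n : Fin N) (i : Fin U ⊕ Fin M) : 0 < S.estVar n i := by
  have := S.pilotEnergy_pos i
  have := S.power_pos n i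
  have := S.obsVar_pos n i
  rw [estVar_eq]
  positivity

lemma sqrt_estVar (n : Fin N) (i : Fin U ⊕ Fin M) :
    √(S.estVar n i) = √S.pilotEnergy * S.power n i / √(S.obsVar n i) := by
  rw [estVar_eq, Real.sqrt_div (mul_nonneg (S.pilotEnergy_pos i).le (sq_nonneg _)),
    Real.sqrt_mul (S.pilotEnergy_pos i).le, Real.sqrt_sq (S.power_pos n i).le]

lemma errVar_eq (n : Fin N) (u : Fin U) :
    S.β n u - S.γ n u = S.power n (.inl u) / S.obsVar n (.inl u) := by
  have h1 : S.γ n u = S.pilotEnergy * S.power n (.inl u) ^ 2 / S.obsVar n (.inl u) :=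
    S.estVar_eq n (.inl u)
  have h2 : S.β n u = S.power n (.inl u) := rfl
  have h3 := (S.obsVar_pos n (.inl u)).ne'
  rw [h1, h2, eq_div_iff h3, sub_mul, div_mul_cancel₀ _ h3, obsVar]
  ring

lemma errVar_pos (n : Fin N) (u : Fin U) : 0 < S.β n u - S.γ n u := by
  rw [errVar_eq]
  exact div_pos (S.power_pos _ _) (S.obsVar_pos _ _)

section rows

variable (n n' : Fin N) (i i' : Fin U ⊕ Fin M) (l l' : Fin L)

lemma ofReal_sqrt_mul_self {r : ℝ} (hr : 0 ≤ r) : (√r : ℂ) * (√r : ℂ) = r := by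
  rw [← Complex.ofReal_mul, Real.mul_self_sqrt hr]

lemma userRow_dotProduct_star_userRow (m m' : Fin M) (k : Fin (K m)) (k' : Fin (K m')) :
    S.userRow n m k l ⬝ᵥ star (S.userRow n' m' k' l') =
      if n = n' ∧ (⟨m, k⟩ : Σ m, Fin (K m)) = ⟨m', k'⟩ ∧ l = l' then (S.βbar n m k : ℂ) else 0 := by
  rw [userRow, userRow, single_dotProduct, Pi.star_apply, Pi.single_apply]
  simp only [Sum.inr.injEq, Sum.inl.injEq, Prod.mk.injEq]
  split_ifs with h
  · obtain ⟨rfl, h, rfl⟩ := h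
    cases h
    simp [ofReal_sqrt_mul_self (S.βbar_pos n m k).le]
  · simp

lemma userRow_dotProduct_star_channelRow (m : Fin M) (k : Fin (K m)) :
    S.userRow n m k l ⬝ᵥ star (S.channelRow n' i' l') =
      if n = n' ∧ .inr m = i' ∧ l = l' then (S.βbar n m k : ℂ) else 0 := by
  rcases i' with u | m'
  · simp [userRow, channelRow]
  · simp only [channelRow, star_sum, dotProduct_sum, userRow_dotProduct_star_userRow]
    by_cases h : n = n' ∧ l = l'
    · obtain ⟨rfl, rfl⟩ := h
      by_cases hm : m = m'
      · subst hm
        simp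
      · simp [hm]
    · have h1 : ∀ p : Prop, ¬ (n = n' ∧ p ∧ l = l') := fun p hp => h ⟨hp.1, hp.2.2⟩
      simp [h1]

lemma channelRow_dotProduct_star_channelRow :
    S.channelRow n i l ⬝ᵥ star (S.channelRow n' i' l') =
      if n = n' ∧ i = i' ∧ l = l' then (S.power n i : ℂ) else 0 := by
  rcases i with u | m
  · rcases i' with u' | m'
    · simp only [channelRow, single_dotProduct, Pi.star_apply, Pi.single_apply, Sum.inl.injEq,
        Prod.mk.injEq]
      split_ifs with h
      · obtain ⟨rfl, rfl, rfl⟩ := h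
        simp [ofReal_sqrt_mul_self (S.β_pos n u).le, power]
      · simp
    · simp [channelRow, userRow, single_dotProduct, Finset.sum_apply]
  · rw [channelRow, sum_dotProduct]
    simp only [userRow_dotProduct_star_channelRow]
    split_ifs
    · simp [power]
    · simp

lemma userRow_dotProduct_star_noiseRow (m : Fin M) (k : Fin (K m)) :
    S.userRow n m k l ⬝ᵥ star (S.noiseRow n' i' l') = 0 := by
  simp [userRow, noiseRow, single_dotProduct]

lemma channelRow_dotProduct_star_noiseRow :
    S.channelRow n i l ⬝ᵥ star (S.noiseRow n' i' l') = 0 := by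
  rcases i with u | m
  · simp [channelRow, noiseRow, single_dotProduct]
  · simp [channelRow, sum_dotProduct, userRow_dotProduct_star_noiseRow]

lemma noiseRow_dotProduct_star_channelRow :
    S.noiseRow n i l ⬝ᵥ star (S.channelRow n' i' l') = 0 := by
  rw [dotProduct_star, channelRow_dotProduct_star_noiseRow, star_zero]

/-- Orthonormal pilots keep the projected noise white, across pilots as well as antennas. -/
lemma noiseRow_dotProduct_star_noiseRow :
    S.noiseRow n i l ⬝ᵥ star (S.noiseRow n' i' l') =
      if n = n' ∧ i = i' ∧ l = l' then 1 else 0 := by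
  have h : ∀ a : Fin N, ∀ b : Fin L,
      ∑ s, (if a = n ∧ b = l then S.pilot i s else 0) *
        star (if a = n' ∧ b = l' then S.pilot i' s else 0) =
      if (a = n ∧ a = n') ∧ (b = l ∧ b = l') then if i = i' then 1 else 0 else 0 := by
    intro a b
    by_cases h1 : a = n ∧ b = l
    · by_cases h2 : a = n' ∧ b = l'
      · have := S.pilot_orthonormal i' i
        rw [dotProduct_comm, dotProduct] at this
        simp only [h1, and_self, if_true, true_and]
        simpa [h1.1.symm, h1.2.symm, h2.1.symm, h2.2.symm, eq_comm] using this
      · have h3 : ¬ ((a = n ∧ a = n') ∧ (b = l ∧ b = l')) := fun h => h2 ⟨h.1.2, h.2.2⟩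
        simp [h2, h3]
    · have h3 : ¬ ((a = n ∧ a = n') ∧ (b = l ∧ b = l')) := fun h => h1 ⟨h.1.1, h.2.1⟩
      simp [h1, h3]
  simp only [noiseRow, dotProduct, Fintype.sum_sum_type, Pi.star_apply, Sum.elim_inl, Sum.elim_inr,
    Pi.zero_apply, zero_mul, Finset.sum_const_zero, zero_add, Fintype.sum_prod_type, h]
  by_cases hn : n = n'
  · subst hn
    by_cases hl : l = l'
    · subst hl
      simp [ite_and]
    · have : ∀ b, ¬ (b = l ∧ b = l') := fun b hb => hl (hb.1.symm.trans hb.2)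
      simp [this, hl]
  · have : ∀ a, ¬ (a = n ∧ a = n') := fun a ha => hn (ha.1.symm.trans ha.2)
    simp [this, hn]

lemma userRow_dotProduct_star_obsRow (m : Fin M) (k : Fin (K m)) :
    S.userRow n m k l ⬝ᵥ star (S.obsRow n' i' l') =
      if n = n' ∧ .inr m = i' ∧ l = l' then ((√S.pilotEnergy * S.βbar n m k : ℝ) : ℂ) else 0 := by
  rw [obsRow, star_add, star_smul, dotProduct_add, dotProduct_smul,
    userRow_dotProduct_star_channelRow, userRow_dotProduct_star_noiseRow]
  split_ifs <;> simp

lemma channelRow_dotProduct_star_obsRow :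
    S.channelRow n i l ⬝ᵥ star (S.obsRow n' i' l') =
      if n = n' ∧ i = i' ∧ l = l' then ((√S.pilotEnergy * S.power n i : ℝ) : ℂ) else 0 := by
  rw [obsRow, star_add, star_smul, dotProduct_add, dotProduct_smul,
    channelRow_dotProduct_star_channelRow, channelRow_dotProduct_star_noiseRow]
  split_ifs <;> simp

lemma obsRow_dotProduct_star_obsRow :
    S.obsRow n i l ⬝ᵥ star (S.obsRow n' i' l') =
      if n = n' ∧ i = i' ∧ l = l' then (S.obsVar n i : ℂ) else 0 := by
  conv_lhs => rw [obsRow, add_dotProduct, smul_dotProduct, channelRow_dotProduct_star_obsRow]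
  rw [obsRow, star_add, star_smul, dotProduct_add, dotProduct_smul,
    noiseRow_dotProduct_star_channelRow, noiseRow_dotProduct_star_noiseRow]
  split_ifs
  · rw [obsVar]
    push_cast
    rw [smul_eq_mul, ← mul_assoc, ofReal_sqrt_mul_self (S.pilotEnergy_pos i).le]
    simp
  · simp

/-- The coefficients of the normalized channel estimates. -/
def estRow (n : Fin N) (i : Fin U ⊕ Fin M) (l : Fin L) : EntryIndex N L U M K τ → ℂ :=
  ((√(S.obsVar n i))⁻¹ : ℂ) • S.obsRow n i l

/-- The coefficients of the normalized estimation errors of a unicast user. -/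
def errRow (u : Fin U) (n : Fin N) (l : Fin L) : EntryIndex N L U M K τ → ℂ :=
  ((√(S.β n u - S.γ n u))⁻¹ : ℂ) • (S.channelRow n (.inl u) l -
    ((√S.pilotEnergy * S.power n (.inl u) / S.obsVar n (.inl u) : ℝ) : ℂ) • S.obsRow n (.inl u) l)

lemma estRow_dotProduct_star_estRow :
    S.estRow n i l ⬝ᵥ star (S.estRow n' i' l') = if n = n' ∧ i = i' ∧ l = l' then 1 else 0 := by
  rw [estRow, estRow, star_smul, smul_dotProduct, dotProduct_smul, obsRow_dotProduct_star_obsRow]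
  split_ifs with h
  · obtain ⟨rfl, rfl, rfl⟩ := h
    have h1 := ofReal_sqrt_mul_self (S.obsVar_pos n i).le
    have h2 : (√(S.obsVar n i) : ℂ) ≠ 0 := by
      exact_mod_cast (Real.sqrt_pos.2 (S.obsVar_pos n i)).ne'
    have h3 : star ((√(S.obsVar n i))⁻¹ : ℂ) = ((√(S.obsVar n i))⁻¹ : ℂ) := by simp
    rw [h3, ← h1, smul_eq_mul, smul_eq_mul]
    field_simp
  · simp

/-- The orthogonality principle: the MMSE coefficient is exactly the one that removes the
correlation with the observation of the same pilot; the others are uncorrelated already. -/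
lemma errRow_dotProduct_star_obsRow (u : Fin U) :
    S.errRow u n l ⬝ᵥ star (S.obsRow n' i' l') = 0 := by
  rw [errRow, smul_dotProduct, sub_dotProduct, smul_dotProduct, channelRow_dotProduct_star_obsRow,
    obsRow_dotProduct_star_obsRow]
  split_ifs with h
  · rw [smul_eq_mul, smul_eq_mul, ← Complex.ofReal_mul, div_mul_cancel₀ _ (S.obsVar_pos _ _).ne',
      sub_self, mul_zero]
  · simp

lemma errRow_dotProduct_star_estRow (u : Fin U) :
    S.errRow u n l ⬝ᵥ star (S.estRow n' i' l') = 0 := by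
  rw [estRow, star_smul, dotProduct_smul, errRow_dotProduct_star_obsRow, smul_zero]

lemma errRow_dotProduct_star_errRow (u : Fin U) :
    S.errRow u n l ⬝ᵥ star (S.errRow u n' l') = if n = n' ∧ l = l' then 1 else 0 := by
  -- The error is orthogonal to the observations, so one of the two error rows may be replaced by
  -- its channel part.
  conv_lhs => rw [errRow.eq_def S u n' l', star_smul, star_sub, star_smul, dotProduct_smul, dotProduct_sub,
    dotProduct_smul, errRow_dotProduct_star_obsRow]
  rw [dotProduct_star, errRow, star_smul, star_sub, star_smul, dotProduct_smul, dotProduct_sub,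
    dotProduct_smul, channelRow_dotProduct_star_channelRow, channelRow_dotProduct_star_obsRow]
  by_cases h : n = n' ∧ l = l'
  · obtain ⟨rfl, rfl⟩ := h
    simp only [and_self, if_true]
    have h1 := ofReal_sqrt_mul_self (S.errVar_pos n u).le
    have h2 : (√(S.β n u - S.γ n u) : ℂ) ≠ 0 := by
      exact_mod_cast (Real.sqrt_pos.2 (S.errVar_pos n u)).ne'
    have h4 : S.power n (.inl u) - √S.pilotEnergy * S.power n (.inl u) / S.obsVar n (.inl u) *
        (√S.pilotEnergy * S.power n (.inl u)) = S.β n u - S.γ n u := by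
      have h5 := (S.obsVar_pos n (.inl u)).ne'
      rw [errVar_eq, eq_div_iff h5]
      field_simp
      rw [Real.sq_sqrt (S.pilotEnergy_pos (.inl u)).le, obsVar]
      ring
    have h6 : (S.power n (.inl u) : ℂ) -
        ((√S.pilotEnergy * S.power n (.inl u) / S.obsVar n (.inl u) : ℝ) : ℂ) *
        ((√S.pilotEnergy * S.power n (.inl u) : ℝ) : ℂ) = ((S.β n u - S.γ n u : ℝ) : ℂ) := by
      rw [← h4]
      push_cast
      ring
    simp only [smul_eq_mul, star_mul', Complex.star_def, Complex.conj_ofReal, map_inv₀, mul_zero,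
      sub_zero, h6]
    rw [← h1]
    field_simp
  · have hc : ¬ (n' = n ∧ (Sum.inl u : Fin U ⊕ Fin M) = .inl u ∧ l' = l) :=
      fun hc => h ⟨hc.1.symm, hc.2.2.symm⟩
    rw [if_neg hc, if_neg hc, if_neg h]
    simp

end rows

end System

/-! ### Estimates, channels and precoders in normalized variables. -/

namespace System

variable (S : System N L U M K τ) (R : Randomness N L U M K τ Ω)

lemma channelRow_dotProduct_entries (n : Fin N) (u : Fin U) (l : Fin L) (ω : Ω) :
    S.channelRow n (.inl u) l ⬝ᵥ R.entries ω = S.c R n u ω l := by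
  rw [channelRow, single_dotProduct]
  rfl

lemma userRow_dotProduct_entries (n : Fin N) (m : Fin M) (k : Fin (K m)) (l : Fin L) (ω : Ω) :
    S.userRow n m k l ⬝ᵥ R.entries ω = S.t R n m k ω l := by
  rw [userRow, single_dotProduct]
  rfl

lemma noiseRow_dotProduct_entries (n : Fin N) (i : Fin U ⊕ Fin M) (l : Fin L) (ω : Ω) :
    S.noiseRow n i l ⬝ᵥ R.entries ω = ∑ s, S.pilot i s * R.Ψ n l s ω := by
  simp only [noiseRow, dotProduct, Fintype.sum_sum_type, Sum.elim_inl, Sum.elim_inr,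
    Pi.zero_apply, zero_mul, Finset.sum_const_zero, zero_add, Fintype.sum_prod_type, ite_and,
    ite_mul]
  rw [Finset.sum_eq_single n (fun a _ ha => by simp [ha]) (by simp),
    Finset.sum_eq_single l (fun a _ ha => by simp [ha]) (by simp)]
  simp only [if_true]
  rfl

lemma obsRow_dotProduct_entries (n : Fin N) (i : Fin U ⊕ Fin M) (l : Fin L) (ω : Ω) :
    S.obsRow n i l ⬝ᵥ R.entries ω = S.y R n i ω l := by
  have hnoise : ((Matrix.of fun l s => R.Ψ n l s ω) *ᵥ S.pilot i) l =
      ∑ s, S.pilot i s * R.Ψ n l s ω := by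
    simp [mulVec, dotProduct, mul_comm]
  rw [obsRow, add_dotProduct, smul_dotProduct, noiseRow_dotProduct_entries, y, Y, add_mulVec,
    add_mulVec, Pi.add_apply, Pi.add_apply, hnoise]
  congr 1
  simp only [smul_mulVec, sum_mulVec, vecMulVec_mulVec, S.pilot_orthonormal, Pi.smul_apply,
    Finset.sum_apply]
  rcases i with u | m
  · simp [channelRow_dotProduct_entries, pilotEnergy]
  · simp [channelRow, sum_dotProduct, userRow_dotProduct_entries, pilotEnergy]

variable [MeasurableSpace Ω] {P : Measure Ω} {R}

lemma corr_y_y (hR : R.IsRayleigh P) (n : Fin N) (i : Fin U ⊕ Fin M) :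
    corr P (S.y R n i) (S.y R n i) = (S.obsVar n i : ℂ) • (1 : Matrix (Fin L) (Fin L) ℂ) := by
  ext l l'
  simp only [corr, Matrix.of_apply, ← obsRow_dotProduct_entries]
  rw [integral_entries_mul_star hR, obsRow_dotProduct_star_obsRow]
  simp [Matrix.one_apply]

lemma corr_c_y (hR : R.IsRayleigh P) (n : Fin N) (u : Fin U) :
    corr P (S.c R n u) (S.y R n (.inl u)) =
      ((√S.pilotEnergy * S.power n (.inl u) : ℝ) : ℂ) • (1 : Matrix (Fin L) (Fin L) ℂ) := by
  ext l l'
  simp only [corr, Matrix.of_apply, ← obsRow_dotProduct_entries, ← channelRow_dotProduct_entries]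
  rw [integral_entries_mul_star hR, channelRow_dotProduct_star_obsRow]
  simp [Matrix.one_apply]

lemma corr_t_y (hR : R.IsRayleigh P) (n : Fin N) (m : Fin M) (k : Fin (K m)) :
    corr P (S.t R n m k) (S.y R n (.inr m)) =
      ((√S.pilotEnergy * S.βbar n m k : ℝ) : ℂ) • (1 : Matrix (Fin L) (Fin L) ℂ) := by
  ext l l'
  simp only [corr, Matrix.of_apply, ← obsRow_dotProduct_entries, ← userRow_dotProduct_entries]
  rw [integral_entries_mul_star hR, userRow_dotProduct_star_obsRow]
  simp [Matrix.one_apply]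

/-- The channel estimates of unicast users and of multicast groups, as one family. -/
def ghat (R : Randomness N L U M K τ Ω) (P : Measure Ω) (n : Fin N) (i : Fin U ⊕ Fin M) (ω : Ω) :
    Fin L → ℂ :=
  Sum.elim (fun u => S.chat R P n u ω) (fun m => S.that R P n m ω) i

/-- The normalized estimation errors of a unicast user together with all normalized channel
estimates. -/
def errEst (R : Randomness N L U M K τ Ω) (u : Fin U) (ω : Ω) :
    (Fin N × Fin L → ℂ) × (Fin N × (Fin U ⊕ Fin M) × Fin L → ℂ) :=
  (fun p => S.errRow u p.1 p.2 ⬝ᵥ R.entries ω,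
    fun q => S.estRow q.1 q.2.1 q.2.2 ⬝ᵥ R.entries ω)

/-- The stacked error and estimate rows are orthonormal, which upgrades uncorrelatedness to full
joint independence. -/
lemma hasLaw_errEst (hR : R.IsRayleigh P) (u : Fin U) :
    HasLaw (S.errEst R u) (errorEstimateLaw (Fin N) (Fin L) (Fin U ⊕ Fin M)) P := by
  let A : (Fin N × Fin L) ⊕ (Fin N × (Fin U ⊕ Fin M) × Fin L) → EntryIndex N L U M K τ → ℂ :=
    Sum.elim (fun p => S.errRow u p.1 p.2) (fun q => S.estRow q.1 q.2.1 q.2.2)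
  have hA : ∀ j k, A j ⬝ᵥ star (A k) = if j = k then 1 else 0 := by
    rintro (⟨n, l⟩ | ⟨n, i, l⟩) (⟨n', l'⟩ | ⟨n', i', l'⟩)
    · simp [A, errRow_dotProduct_star_errRow]
    · simp [A, errRow_dotProduct_star_estRow]
    · simp only [A, Sum.elim_inl, Sum.elim_inr]
      rw [dotProduct_star, errRow_dotProduct_star_estRow]
      simp
    · simp [A, estRow_dotProduct_star_estRow]
  have h1 := (hasLaw_dotProduct_iidGaussian A hA).comp hR.hasLaw_entries
  exact (measurePreserving_sumPiEquivProdPi fun _ => stdComplexGaussian).hasLaw.comp h1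

/-- The users of a group share one observation, so their MMSE coefficients add up to that of the
total `power`. The user `u` only selects the error component of `errEst`; the estimate component
does not depend on it. -/
lemma ghat_eq (hR : R.IsRayleigh P) (u : Fin U) (n : Fin N) (i : Fin U ⊕ Fin M) (ω : Ω)
    (l : Fin L) : S.ghat R P n i ω l = √(S.estVar n i) * (S.errEst R u ω).2 (n, i, l) := by
  have hq : (S.obsVar n i : ℂ) ≠ 0 := by exact_mod_cast (S.obsVar_pos n i).ne'
  have hs : (√(S.obsVar n i) : ℂ) ≠ 0 := by
    exact_mod_cast (Real.sqrt_pos.2 (S.obsVar_pos n i)).ne'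
  have hR' : (√(S.estVar n i) : ℂ) * (S.errEst R u ω).2 (n, i, l) =
      ((√S.pilotEnergy * S.power n i : ℝ) : ℂ) / S.obsVar n i * S.y R n i ω l := by
    simp only [errEst, estRow]
    rw [smul_dotProduct, obsRow_dotProduct_entries, sqrt_estVar, smul_eq_mul,
      ← ofReal_sqrt_mul_self (S.obsVar_pos n i).le]
    push_cast
    field_simp
  rw [hR']
  rcases i with u' | m
  · exact mmse_of_scalar_corr hq (S.corr_c_y hR n u') (S.corr_y_y hR n _) ω l
  · simp only [ghat, Sum.elim_inr, that, Finset.sum_apply]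
    rw [Finset.sum_congr rfl fun k _ =>
      mmse_of_scalar_corr hq (S.corr_t_y hR n m k) (S.corr_y_y hR n _) ω l, ← Finset.sum_mul,
      ← Finset.sum_div, ← Complex.ofReal_sum, ← Finset.mul_sum]
    rfl

omit [MeasurableSpace Ω] in
lemma c_eq (u : Fin U) (n : Fin N) (ω : Ω) (l : Fin L) :
    S.c R n u ω l = √(S.γ n u) * (S.errEst R u ω).2 (n, .inl u, l) +
      √(S.β n u - S.γ n u) * (S.errEst R u ω).1 (n, l) := by
  have hs : (√(S.obsVar n (.inl u)) : ℂ) ≠ 0 := by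
    exact_mod_cast (Real.sqrt_pos.2 (S.obsVar_pos n _)).ne'
  have hd : (√(S.β n u - S.γ n u) : ℂ) ≠ 0 := by
    exact_mod_cast (Real.sqrt_pos.2 (S.errVar_pos n u)).ne'
  have hg : √(S.γ n u) = √S.pilotEnergy * S.power n (.inl u) / √(S.obsVar n (.inl u)) :=
    S.sqrt_estVar n (.inl u)
  simp only [errEst, estRow, errRow]
  rw [smul_dotProduct, smul_dotProduct, sub_dotProduct, smul_dotProduct,
    channelRow_dotProduct_entries, obsRow_dotProduct_entries, hg, smul_eq_mul, smul_eq_mul,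
    smul_eq_mul, Complex.ofReal_div _ (S.obsVar n (.inl u)),
    ← ofReal_sqrt_mul_self (S.obsVar_pos n (.inl u)).le]
  push_cast
  field_simp
  ring

lemma integral_norm_sq_ghat (hR : R.IsRayleigh P) (u : Fin U) (n : Fin N) (i : Fin U ⊕ Fin M)
    (l : Fin L) : ∫ ω, ‖S.ghat R P n i ω l‖ ^ 2 ∂P = S.estVar n i := by
  simp_rw [S.ghat_eq hR u]
  have h := (S.hasLaw_errEst hR u).integral_comp (f := fun x => ‖x.2 (n, i, l)‖ ^ 2)
    (Measurable.aestronglyMeasurable (by fun_prop))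
  have h2 : ∫ x, ‖x.2 (n, i, l)‖ ^ 2 ∂errorEstimateLaw (Fin N) (Fin L) (Fin U ⊕ Fin M) = 1 := by
    refine (integral_fun_snd
      (f := fun z : Fin N × (Fin U ⊕ Fin M) × Fin L → ℂ => ‖z (n, i, l)‖ ^ 2)).trans ?_
    rw [integral_norm_sq_eval_iidGaussian]
    simp
  simp only [norm_mul, mul_pow, integral_const_mul]
  rw [show ∫ ω, ‖(S.errEst R u ω).2 (n, i, l)‖ ^ 2 ∂P = 1 from h.trans h2, Complex.norm_real,
    Real.norm_eq_abs, sq_abs, Real.sq_sqrt (S.estVar_pos n i).le, mul_one]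

lemma Ghat_eq (hR : R.IsRayleigh P) (u : Fin U) (n : Fin N) (ω : Ω) :
    S.Ghat R P n ω = ofCols (estimateCols n (S.errEst R u ω).2) *
      diagonal fun i => (√(S.estVar n i) : ℂ) := by
  ext l i
  rw [Matrix.mul_diagonal, ofCols, Matrix.of_apply, estimateCols, mul_comm, ← S.ghat_eq hR u]
  rcases i with u' | m <;> rfl

/-- The precoding vectors of unicast users and of multicast groups, as one family. -/
def precoder (R : Randomness N L U M K τ Ω) (P : Measure Ω) (ς : Precoding) (n : Fin N)
    (i : Fin U ⊕ Fin M) (ω : Ω) : Fin L → ℂ :=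
  Sum.elim (fun u => S.b R P ς n u ω) (fun m => S.bbar R P ς n m ω) i

lemma precoder_MR (hR : R.IsRayleigh P) (u : Fin U) (n : Fin N) (i : Fin U ⊕ Fin M) (ω : Ω)
    (l : Fin L) :
    S.precoder R P .MR n i ω l = √(S.estVar n i) * (S.errEst R u ω).2 (n, i, l) := by
  rw [← S.ghat_eq hR u]
  rcases i with u' | m <;> rfl

lemma precoder_ZF (hR : R.IsRayleigh P) (u : Fin U) (n : Fin N) (i : Fin U ⊕ Fin M) (ω : Ω)
    (l : Fin L) :
    S.precoder R P .ZF n i ω l =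
      zfMatrix (ofCols (estimateCols n (S.errEst R u ω).2)) l i * (√(S.estVar n i) : ℂ)⁻¹ := by
  have h1 : S.precoder R P .ZF n i ω = zfMatrix (S.Ghat R P n ω) *ᵥ Pi.single i 1 := by
    rcases i with u' | m <;> rfl
  rw [h1, Matrix.mulVec_single_one, S.Ghat_eq hR u,
    zfMatrix_mul_diagonal _ fun i => (Real.sqrt_pos.2 (S.estVar_pos n i)).ne',
    Matrix.col_apply, Matrix.mul_diagonal]

lemma ae_isUnit_gram_estimateCols (hR : R.IsRayleigh P) (u : Fin U) (h : U + M < L) (n : Fin N) :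
    ∀ᵐ ω ∂P, IsUnit ((ofCols (estimateCols n (S.errEst R u ω).2))ᴴ *
      ofCols (estimateCols n (S.errEst R u ω).2)) := by
  have h1 : ∀ᵐ x ∂Measure.pi fun _ : Fin U ⊕ Fin M => iidGaussian (Fin L),
      IsUnit ((ofCols x)ᴴ * ofCols x) := by
    filter_upwards [ae_linearIndependent (ι := Fin L) (κ := Fin U ⊕ Fin M) (by simp; omega)]
      with x hx using isUnit_gram_ofCols hx
  have h2 := (measurePreserving_estimateCols (ι := Fin L) n).quasiMeasurePreserving.ae h1
  have h3 := Measure.quasiMeasurePreserving_snd (μ := iidGaussian (Fin N × Fin L))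
    (ν := iidGaussian (Fin N × (Fin U ⊕ Fin M) × Fin L)) |>.ae h2
  have hlaw := S.hasLaw_errEst hR u
  refine ae_of_ae_map (p := fun x => IsUnit ((ofCols (estimateCols n x.2))ᴴ *
    ofCols (estimateCols n x.2))) hlaw.aemeasurable ?_
  rw [hlaw.map_eq]
  exact h3

lemma isUnit_gram_Ghat (hR : R.IsRayleigh P) (u : Fin U) (n : Fin N) (ω : Ω)
    (h : IsUnit ((ofCols (estimateCols n (S.errEst R u ω).2))ᴴ *
      ofCols (estimateCols n (S.errEst R u ω).2))) :
    IsUnit ((S.Ghat R P n ω)ᴴ * S.Ghat R P n ω) := by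
  have hD : IsUnit (diagonal fun i => (√(S.estVar n i) : ℂ)) := by
    rw [Matrix.isUnit_iff_isUnit_det, Matrix.det_diagonal, isUnit_iff_ne_zero]
    exact Finset.prod_ne_zero_iff.2 fun i _ => by
      exact_mod_cast (Real.sqrt_pos.2 (S.estVar_pos n i)).ne'
  rw [S.Ghat_eq hR u, Matrix.conjTranspose_mul, Matrix.mul_assoc, ← Matrix.mul_assoc _ᴴ (ofCols _)]
  exact hD.star.mul (h.mul hD)

end System

/-! ### Signals and the SINR. -/

namespace System

variable (S : System N L U M K τ) [MeasurableSpace Ω] {P : Measure Ω}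
  {R : Randomness N L U M K τ Ω}

/-- The amplitude with which an access point transmits the symbol of a user or group. -/
def weight (n : Fin N) : Fin U ⊕ Fin M → ℝ :=
  Sum.elim (fun u => S.a n u * √(S.η n u)) (fun m => S.abar n m * √(S.ηbar n m))

/-- Binary association gives `a² = a`. -/
lemma weight_inl_sq (n : Fin N) (u : Fin U) : S.weight n (.inl u) ^ 2 = S.a n u * S.η n u := by
  simp only [weight, Sum.elim_inl, mul_pow, Real.sq_sqrt (S.η_nonneg n u)]
  rcases S.a_binary n u with h | h <;> simp [h]

lemma weight_inr_sq (n : Fin N) (m : Fin M) :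
    S.weight n (.inr m) ^ 2 = S.abar n m * S.ηbar n m := by
  simp only [weight, Sum.elim_inr, mul_pow, Real.sq_sqrt (S.ηbar_nonneg n m)]
  rcases S.abar_binary n m with h | h <;> simp [h]

/-- The gain at a unicast user of the symbol of a user or group, without the transmit power. -/
def signal (R : Randomness N L U M K τ Ω) (P : Measure Ω) (ς : Precoding) (u : Fin U)
    (i : Fin U ⊕ Fin M) (ω : Ω) : ℂ :=
  ∑ n, (S.weight n i : ℂ) * (star (S.c R n u ω) ⬝ᵥ S.precoder R P ς n i ω)

lemma UI_eq_signal (ς : Precoding) (u u' : Fin U) (ω : Ω) :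
    S.UI R P ς u u' ω = √S.pdl * S.signal R P ς u (.inl u') ω := by
  simp [UI, signal, weight, precoder]

lemma MI_eq_signal (ς : Precoding) (u : Fin U) (m : Fin M) (ω : Ω) :
    S.MI R P ς u m ω = √S.pdl * S.signal R P ς u (.inr m) ω := by
  simp [MI, signal, weight, precoder]

lemma DS_eq_signal (ς : Precoding) (u : Fin U) :
    S.DS R P ς u = √S.pdl * ∫ ω, S.signal R P ς u (.inl u) ω ∂P := by
  simp [DS, signal, weight, precoder]

/-- The SINR in terms of the mean of the desired signal and the variances of all signals. -/
lemma SINR_of_signal [IsProbabilityMeasure P] {ς : Precoding} {u : Fin U} {μ : ℝ}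
    {X : Fin U ⊕ Fin M → Ω → ℂ} {v : Fin U ⊕ Fin M → ℝ} (hX : ∀ i, MemLp (X i) 2 P)
    (h0 : ∀ i, ∫ ω, X i ω ∂P = 0) (hv : ∀ i, ∫ ω, ‖X i ω‖ ^ 2 ∂P = v i)
    (hs : ∀ i, S.signal R P ς u i =ᵐ[P] fun ω => (if i = .inl u then (μ : ℂ) else 0) + X i ω) :
    (∀ u', MemLp (S.UI R P ς u u') 2 P) ∧ (∀ m, MemLp (S.MI R P ς u m) 2 P) ∧
      S.SINR R P ς u =
        (√S.pdl * μ) ^ 2 / (S.pdl * (∑ u', v (.inl u') + ∑ m, v (.inr m)) + 1) := by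
  have hmem : ∀ i, MemLp (S.signal R P ς u i) 2 P := fun i => by
    have h := (memLp_const (p := 2) (μ := P) (if i = .inl u then (μ : ℂ) else 0)).add (hX i)
    exact (memLp_congr_ae (hs i)).2 h
  have hUI : ∀ u', S.UI R P ς u u' = fun ω => √S.pdl * S.signal R P ς u (.inl u') ω :=
    fun u' => funext fun ω => S.UI_eq_signal ς u u' ω
  have hMI : ∀ m, S.MI R P ς u m = fun ω => √S.pdl * S.signal R P ς u (.inr m) ω :=
    fun m => funext fun ω => S.MI_eq_signal ς u m ω
  have hmean : ∫ ω, S.signal R P ς u (.inl u) ω ∂P = μ := by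
    rw [integral_congr_ae (hs _), integral_add (integrable_const _)
      ((hX _).integrable (by norm_num)), h0]
    simp
  have hscale : ∀ Y : Ω → ℂ, ∫ ω, ‖(√S.pdl : ℂ) * Y ω‖ ^ 2 ∂P = S.pdl * ∫ ω, ‖Y ω‖ ^ 2 ∂P := by
    intro Y
    rw [← integral_const_mul]
    refine integral_congr_ae (.of_forall fun ω => ?_)
    simp only [norm_mul, mul_pow, Complex.norm_real, Real.norm_eq_abs, sq_abs,
      Real.sq_sqrt S.pdl_nonneg]
  have hsq : ∀ i, i ≠ .inl u → ∫ ω, ‖S.signal R P ς u i ω‖ ^ 2 ∂P = v i := by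
    intro i hi
    rw [← hv i]
    refine integral_congr_ae ?_
    filter_upwards [hs i] with ω hω
    rw [hω, if_neg hi, zero_add]
  -- Subtracting the mean leaves exactly the fluctuation `X (.inl u)`.
  have hBU : ∫ ω, ‖S.BU R P ς u ω‖ ^ 2 ∂P = S.pdl * v (.inl u) := by
    rw [← hv, ← hscale]
    refine integral_congr_ae ?_
    filter_upwards [hs (.inl u)] with ω hω
    rw [BU, hUI, integral_const_mul, hmean]
    beta_reduce
    rw [hω, if_pos rfl]
    congr 2
    ring
  refine ⟨fun u' => ?_, fun m => ?_, ?_⟩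
  · rw [hUI]
    exact (hmem _).const_mul _
  · rw [hMI]
    exact (hmem _).const_mul _
  · rw [SINR, hBU, DS_eq_signal, hmean, ← Complex.ofReal_mul, Complex.norm_real, Real.norm_eq_abs,
      sq_abs]
    have h1 : ∀ u' ∈ Finset.univ.erase u, ∫ ω, ‖S.UI R P ς u u' ω‖ ^ 2 ∂P = S.pdl * v (.inl u') := by
      intro u' hu'
      rw [hUI, hscale, hsq _ fun h => Finset.ne_of_mem_erase hu' (Sum.inl_injective h)]
    have h2 : ∀ m, ∫ ω, ‖S.MI R P ς u m ω‖ ^ 2 ∂P = S.pdl * v (.inr m) := by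
      intro m
      rw [hMI, hscale, hsq _ (by simp)]
    -- The beamforming uncertainty fills in the term `u' = u` removed from the interference sum.
    rw [Finset.sum_congr rfl h1, Finset.sum_congr rfl fun m _ => h2 m,
      Finset.add_sum_erase _ (fun u' => S.pdl * v (.inl u')) (Finset.mem_univ u),
      ← Finset.mul_sum, ← Finset.mul_sum, ← mul_add]

/-- Inserting `c_eq` splits the inner product into estimate and error parts; the constants removed
by `centredProduct` sum over the `L` antennas to the mean. -/
lemma signal_MR_eq (hR : R.IsRayleigh P) (u : Fin U) (i : Fin U ⊕ Fin M) (ω : Ω) :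
    S.signal R P .MR u i ω =
      (if i = .inl u then ((∑ n, S.weight n (.inl u) * (L * S.γ n u) : ℝ) : ℂ) else 0) +
      mrFluctuation (.inl u) i
        (fun n => ((S.weight n i * √(S.γ n u) * √(S.estVar n i) : ℝ) : ℂ))
        (fun n => ((S.weight n i * √(S.β n u - S.γ n u) * √(S.estVar n i) : ℝ) : ℂ))
        (S.errEst R u ω) := by
  have hmean : (if i = .inl u then ((∑ n, S.weight n (.inl u) * (L * S.γ n u) : ℝ) : ℂ) else 0) =
      ∑ n, ∑ _l : Fin L, ((S.weight n i * √(S.γ n u) * √(S.estVar n i) : ℝ) : ℂ) *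
        (if i = .inl u then 1 else 0) := by
    split_ifs with h
    · subst h
      push_cast
      refine Finset.sum_congr rfl fun n _ => ?_
      have h1 : S.estVar n (.inl u) = S.γ n u := rfl
      have h2 := ofReal_sqrt_mul_self (h1 ▸ S.estVar_pos n (.inl u)).le
      rw [Finset.sum_const, Finset.card_univ, Fintype.card_fin, nsmul_eq_mul, h1]
      linear_combination -(S.weight n (.inl u) * L : ℂ) * h2
    · simp
  rw [hmean, mrFluctuation, mrEstimatePart, Fintype.sum_prod_type, Fintype.sum_prod_type,
    ← Finset.sum_add_distrib, ← Finset.sum_add_distrib, signal]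
  refine Finset.sum_congr rfl fun n _ => ?_
  rw [dotProduct, Finset.mul_sum, ← Finset.sum_add_distrib, ← Finset.sum_add_distrib]
  refine Finset.sum_congr rfl fun l _ => ?_
  rw [S.precoder_MR hR u, Pi.star_apply, c_eq, centredProduct]
  have hc : ((n, (Sum.inl u : Fin U ⊕ Fin M), l) = (n, i, l)) ↔ i = .inl u := by
    simp [eq_comm]
  simp only [hc, star_add, star_mul', Complex.star_def, Complex.conj_ofReal]
  push_cast
  ring

/-- The identity `Gᴴ * zfMatrix G = 1` makes the estimate part deterministic, and for the user's own
symbol the factors `√γ` and `(√γ)⁻¹` cancel. -/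
lemma signal_ZF_eq (hR : R.IsRayleigh P) (u : Fin U) (i : Fin U ⊕ Fin M) (ω : Ω)
    (h : ∀ n, IsUnit ((ofCols (estimateCols n (S.errEst R u ω).2))ᴴ *
      ofCols (estimateCols n (S.errEst R u ω).2))) :
    S.signal R P .ZF u i ω =
      (if i = .inl u then ((∑ n, S.weight n (.inl u) : ℝ) : ℂ) else 0) +
      zfFluctuation i
        (fun n => ((S.weight n i * √(S.β n u - S.γ n u) * (√(S.estVar n i))⁻¹ : ℝ) : ℂ))
        (S.errEst R u ω) := by
  have hmean : (if i = .inl u then ((∑ n, S.weight n (.inl u) : ℝ) : ℂ) else 0) =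
      ∑ n, ((S.weight n i * √(S.γ n u) * (√(S.estVar n i))⁻¹ : ℝ) : ℂ) *
        (if i = .inl u then 1 else 0) := by
    split_ifs with h
    · subst h
      push_cast
      refine Finset.sum_congr rfl fun n _ => ?_
      have h1 : S.estVar n (.inl u) = S.γ n u := rfl
      have h2 : (√(S.γ n u) : ℂ) ≠ 0 := by
        exact_mod_cast (Real.sqrt_pos.2 (h1 ▸ S.estVar_pos n (.inl u))).ne'
      rw [h1]
      field_simp
    · simp
  rw [hmean, zfFluctuation, zero_add, Fintype.sum_prod_type, ← Finset.sum_add_distrib, signal]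
  refine Finset.sum_congr rfl fun n _ => ?_
  have hone := congrFun (congrFun (conjTranspose_mul_zfMatrix (h n)) (.inl u)) i
  have hone' : ∑ l, star ((S.errEst R u ω).2 (n, .inl u, l)) *
      zfMatrix (ofCols (estimateCols n (S.errEst R u ω).2)) l i = if i = .inl u then 1 else 0 := by
    rw [Matrix.one_apply, Matrix.mul_apply] at hone
    simp only [eq_comm (a := i)]
    exact hone
  rw [← hone', dotProduct, Finset.mul_sum, Finset.mul_sum, ← Finset.sum_add_distrib]
  refine Finset.sum_congr rfl fun l _ => ?_
  rw [S.precoder_ZF hR u, Pi.star_apply, c_eq]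
  simp only [star_add, star_mul', Complex.star_def, Complex.conj_ofReal]
  push_cast
  ring

end System

/-! ### Transfer to the probability space and closed forms. -/

section transfer

variable [MeasurableSpace Ω] {P : Measure Ω} {β : Type*} [MeasurableSpace β] {ρ : Measure β}
  {Y : Ω → β} {f : β → ℂ}

lemma memLp_comp_of_hasLaw (hY : HasLaw Y ρ P) (hf : MemLp f 2 ρ) :
    MemLp (fun ω => f (Y ω)) 2 P :=
  (hY.map_eq ▸ hf : MemLp f 2 (P.map Y)).comp_of_map hY.aemeasurable

lemma integral_norm_sq_comp_of_hasLaw (hY : HasLaw Y ρ P) (hf : MemLp f 2 ρ) :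
    ∫ ω, ‖f (Y ω)‖ ^ 2 ∂P = ∫ x, ‖f x‖ ^ 2 ∂ρ :=
  hY.integral_comp (f := fun x => ‖f x‖ ^ 2) (hf.1.norm.pow 2)

end transfer

namespace System

variable (S : System N L U M K τ) [MeasurableSpace Ω] {P : Measure Ω} [IsProbabilityMeasure P]
  {R : Randomness N L U M K τ Ω}

lemma SINR_MR (hR : R.IsRayleigh P) (u : Fin U) :
    (∀ u', MemLp (S.UI R P .MR u u') 2 P) ∧ (∀ m, MemLp (S.MI R P .MR u m) 2 P) ∧
      S.SINR R P .MR u =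
        (√S.pdl * L * ∑ n, S.a n u * √(S.η n u) * S.γ n u) ^ 2 /
          (S.pdl * (L * ∑ u', ∑ n, S.a n u' * S.η n u' * S.β n u * S.γ n u' +
              L * ∑ m, ∑ n, S.abar n m * S.ηbar n m * S.β n u * S.ζ n m) + 1) := by
  have hlaw := S.hasLaw_errEst hR u
  let F : Fin U ⊕ Fin M → (Fin N × Fin L → ℂ) × (Fin N × (Fin U ⊕ Fin M) × Fin L → ℂ) → ℂ :=
    fun i => mrFluctuation (.inl u) i
      (fun n => ((S.weight n i * √(S.γ n u) * √(S.estVar n i) : ℝ) : ℂ))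
      (fun n => ((S.weight n i * √(S.β n u - S.γ n u) * √(S.estVar n i) : ℝ) : ℂ))
  have hF : ∀ i, MemLp (F i) 2 (errorEstimateLaw (Fin N) (Fin L) (Fin U ⊕ Fin M)) :=
    fun i => memLp_mrFluctuation _ _ _ _
  have h0 : ∀ i, ∫ ω, F i (S.errEst R u ω) ∂P = 0 := fun i =>
    (hlaw.integral_comp (hF i).1).trans (integral_mrFluctuation _ _ _ _)
  have hv : ∀ i : Fin U ⊕ Fin M, ∫ ω, ‖F i (S.errEst R u ω)‖ ^ 2 ∂P = L * ∑ n, S.weight n i ^ 2 * S.β n u * S.estVar n i := by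
    intro i
    rw [integral_norm_sq_comp_of_hasLaw hlaw (hF i),
      integral_norm_sq_mrFluctuation, Fintype.card_fin]
    congr 1
    refine Finset.sum_congr rfl fun n _ => ?_
    have h1 : 0 ≤ S.γ n u := (S.estVar_pos n (.inl u)).le
    simp only [Complex.norm_real, Real.norm_eq_abs, sq_abs, mul_pow, Real.sq_sqrt h1,
      Real.sq_sqrt (S.estVar_pos n i).le, Real.sq_sqrt (S.errVar_pos n u).le]
    -- The estimate part and the error part combine through `γ + (β - γ) = β`.
    ring
  obtain ⟨h1, h2, h3⟩ := S.SINR_of_signal (fun i => memLp_comp_of_hasLaw hlaw (hF i)) h0 hv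
    (fun i => .of_forall fun ω => S.signal_MR_eq hR u i ω)
  refine ⟨h1, h2, h3.trans ?_⟩
  simp only [weight_inl_sq, weight_inr_sq, ← Finset.mul_sum, estVar, Sum.elim_inl, Sum.elim_inr]
  simp only [weight, Sum.elim_inl]
  congr 2
  rw [mul_assoc, Finset.mul_sum _ _ (L : ℝ)]
  congr 1
  exact Finset.sum_congr rfl fun n _ => by ring

lemma SINR_ZF (hR : R.IsRayleigh P) (u : Fin U) (h : U + M < L) :
    (∀ u', MemLp (S.UI R P .ZF u u') 2 P) ∧ (∀ m, MemLp (S.MI R P .ZF u m) 2 P) ∧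
      S.SINR R P .ZF u =
        (√S.pdl * ∑ n, S.a n u * √(S.η n u)) ^ 2 /
          (S.pdl * (∑ u', ∑ n, S.a n u' * S.η n u' *
                ((S.β n u - S.γ n u) / (((L : ℝ) - U - M) * S.γ n u')) +
              ∑ m, ∑ n, S.abar n m * S.ηbar n m *
                ((S.β n u - S.γ n u) / (((L : ℝ) - U - M) * S.ζ n m))) + 1) := by
  have hlaw := S.hasLaw_errEst hR u
  have hcard : Fintype.card (Fin U ⊕ Fin M) < Fintype.card (Fin L) := by simpa using h
  let F : Fin U ⊕ Fin M → (Fin N × Fin L → ℂ) × (Fin N × (Fin U ⊕ Fin M) × Fin L → ℂ) → ℂ :=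
    fun i => zfFluctuation i
      (fun n => ((S.weight n i * √(S.β n u - S.γ n u) * (√(S.estVar n i))⁻¹ : ℝ) : ℂ))
  have hF : ∀ i, MemLp (F i) 2 (errorEstimateLaw (Fin N) (Fin L) (Fin U ⊕ Fin M)) :=
    fun i => memLp_zfFluctuation hcard _ _
  have h0 : ∀ i, ∫ ω, F i (S.errEst R u ω) ∂P = 0 := fun i =>
    (hlaw.integral_comp (hF i).1).trans (integral_zfFluctuation hcard _ _)
  have hv : ∀ i : Fin U ⊕ Fin M, ∫ ω, ‖F i (S.errEst R u ω)‖ ^ 2 ∂P = ∑ n, S.weight n i ^ 2 *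
          ((S.β n u - S.γ n u) / (((L : ℝ) - U - M) * S.estVar n i)) := by
    intro i
    rw [integral_norm_sq_comp_of_hasLaw hlaw (hF i),
      integral_norm_sq_zfFluctuation hcard]
    refine Finset.sum_congr rfl fun n _ => ?_
    simp only [Complex.norm_real, Real.norm_eq_abs, sq_abs, mul_pow, inv_pow,
      Real.sq_sqrt (S.estVar_pos n i).le, Real.sq_sqrt (S.errVar_pos n u).le, Fintype.card_sum,
      Fintype.card_fin, Nat.cast_add, ← sub_sub]
    rw [div_eq_mul_inv, mul_inv]
    ring
  obtain ⟨h1, h2, h3⟩ := S.SINR_of_signal (fun i => memLp_comp_of_hasLaw hlaw (hF i)) h0 hv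
    (fun i => by
      filter_upwards [ae_all_iff.2 fun n => S.ae_isUnit_gram_estimateCols hR u h n] with ω hω
      exact S.signal_ZF_eq hR u i ω hω)
  refine ⟨h1, h2, h3.trans ?_⟩
  simp only [weight_inl_sq, weight_inr_sq, estVar, Sum.elim_inl, Sum.elim_inr]
  simp only [weight, Sum.elim_inl]

end System

end CellFree

end

theorem proposition1 {N L U M : ℕ} {K : Fin M → ℕ} {τ : ℕ} {Ω : Type*} [MeasurableSpace Ω]
    (P : Measure Ω) [IsProbabilityMeasure P]
    (S : CellFree.System N L U M K τ) (R : CellFree.Randomness N L U M K τ Ω)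
    (hR : R.IsRayleigh P) (u : Fin U) :
    -- `γ` and `ζ` are the variances of the entries of the channel estimates
    (∀ n u' l, ∫ ω, ‖S.chat R P n u' ω l‖ ^ 2 ∂P = S.γ n u') ∧
    (∀ n m l, ∫ ω, ‖S.that R P n m ω l‖ ^ 2 ∂P = S.ζ n m) ∧
    -- MR precoding
    ((∀ u', MemLp (S.UI R P .MR u u') 2 P) ∧
      (∀ m, MemLp (S.MI R P .MR u m) 2 P) ∧
      S.SINR R P .MR u =
        (√S.pdl * L * ∑ n, S.a n u * √(S.η n u) * S.γ n u) ^ 2 /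
          (S.pdl * (L * ∑ u', ∑ n, S.a n u' * S.η n u' * S.β n u * S.γ n u' +
              L * ∑ m, ∑ n, S.abar n m * S.ηbar n m * S.β n u * S.ζ n m) + 1)) ∧
    -- ZF precoding
    (U + M < L →
      (∀ n, ∀ᵐ ω ∂P, IsUnit ((S.Ghat R P n ω)ᴴ * S.Ghat R P n ω)) ∧
      (∀ u', MemLp (S.UI R P .ZF u u') 2 P) ∧
      (∀ m, MemLp (S.MI R P .ZF u m) 2 P) ∧
      S.SINR R P .ZF u =
        (√S.pdl * ∑ n, S.a n u * √(S.η n u)) ^ 2 /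
          (S.pdl * (∑ u', ∑ n, S.a n u' * S.η n u' *
                ((S.β n u - S.γ n u) / (((L : ℝ) - U - M) * S.γ n u')) +
              ∑ m, ∑ n, S.abar n m * S.ηbar n m *
                ((S.β n u - S.γ n u) / (((L : ℝ) - U - M) * S.ζ n m))) + 1)) := by
  refine ⟨fun n u' l => S.integral_norm_sq_ghat hR u n (.inl u') l,
    fun n m l => S.integral_norm_sq_ghat hR u n (.inr m) l, S.SINR_MR hR u,
    fun h => ⟨fun n => ?_, S.SINR_ZF hR u h⟩⟩
  filter_upwards [S.ae_isUnit_gram_estimateCols hR u h n] with ω hω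
  exact S.isUnit_gram_Ghat hR u n ω hω
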